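/- For a positive integer $k$, a distance-$k$ matching in a finite simple graph $G$ is a set $M$ of edges such that any two distinct edges of $M$ are at distance at least $k$, where the distance of two edges is the least distance in $G$ between an end of the first and an end of the second; it is maximal if no other distance-$k$ matching contains it. The problem $k$-WMMM is: given $G$ and a weight function $w\colon E(G)\to\mathbb{Q}_{>0}$, find a maximal distance-$k$ matching of minimum total weight. Set Cover is: given a finite set $X$ and a finite collection $S$ of subsets of $X$ whose union is $X$, find as few members of $S$ as possible that cover $X$. A graph is chordal if it has no induced cycle of length at least $4$. A polynomial $\rho$-approximation algorithm for a minimization problem is a polynomial-time algorithm that on every instance outputs a feasible solution of cost at most $\max(1,\rho)$ times the optimum. Theorem. Let $l$ be a positive integer and $c>0$ a rational constant. Suppose that there is a polynomial $c\ln|V(G)|$-approximation algorithm for $2l$-WMMM on chordal graphs $G$. Then for every integer $d>1$ there is a polynomial $c(d+1)\ln|X|$-approximation algorithm for Set Cover restricted to the instances with $|S|\le|X|^d$. -/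

import Mathlib

/-! ### Programs on binary trees, with a step count

Algorithms are written in a first-order language on binary trees (a pure Lisp, or the WHILE language
on trees, in combinator form). Every elementary operation costs one step. As trees are immutable,
each step is a bounded number of pointer operations; conversely a Turing machine step is a bounded
number of operations on two lists. So polynomial time here is the usual polynomial time. -/

/-- Binary trees: the data of programs. -/
inductive Data : Type
  | nil : Data
  | cons (a b : Data) : Data

namespace Data

/-- The number of nodes of a tree: the length of an input. -/
def size : Data → ℕ
  | nil => 1
  | cons a b => a.size + b.size + 1

/-- First component; `nil` for the empty tree. -/
def head : Data → Data
  | nil => nil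
  | cons a _ => a

/-- Second component; `nil` for the empty tree. -/
def tail : Data → Data
  | nil => nil
  | cons _ b => b

/-- A list of trees as a tree. -/
def ofList : List Data → Data
  | [] => nil
  | a :: s => cons a (ofList s)

/-- A bit as a tree. -/
def ofBool (b : Bool) : Data := if b then cons nil nil else nil

/-- A natural number in unary notation. -/
def ofUnary (n : ℕ) : Data := ofList (List.replicate n nil)

/-- A natural number in binary notation, least significant bit first. -/
def ofNat (n : ℕ) : Data := ofList (n.bits.map ofBool)

/-- A nonnegative rational number: numerator and denominator (in lowest terms) in binary. -/
def ofRat (q : ℚ) : Data := cons (ofNat q.num.toNat) (ofNat q.den)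

end Data

/-- Programs. A program acts on a single tree. -/
inductive Prog : Type
  /-- return the argument -/
  | id : Prog
  /-- return the empty tree -/
  | nil : Prog
  /-- return the first component of the argument -/
  | head : Prog
  /-- return the second component of the argument -/
  | tail : Prog
  /-- run `f` and `g` on the argument and join the two results -/
  | cons (f g : Prog) : Prog
  /-- run `f`, then run `g` on the result -/
  | comp (g f : Prog) : Prog
  /-- run `f` if the test `c` gives a nonempty tree, and `g` otherwise -/
  | cond (c f g : Prog) : Prog
  /-- as long as the test `c` gives a nonempty tree on the current value, replace the current value
  by the result of `f` on it -/
  | loop (c f : Prog) : Prog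

/-- `Runs p x y t`: on input `x` the program `p` halts with output `y` after exactly `t` steps. -/
inductive Runs : Prog → Data → Data → ℕ → Prop
  | id (x : Data) : Runs Prog.id x x 1
  | nil (x : Data) : Runs Prog.nil x Data.nil 1
  | head (x : Data) : Runs Prog.head x x.head 1
  | tail (x : Data) : Runs Prog.tail x x.tail 1
  | cons {f g : Prog} {x a b : Data} {s t : ℕ} :
      Runs f x a s → Runs g x b t → Runs (Prog.cons f g) x (Data.cons a b) (s + t + 1)
  | comp {g f : Prog} {x y z : Data} {s t : ℕ} :
      Runs f x y s → Runs g y z t → Runs (Prog.comp g f) x z (s + t + 1)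
  | cond_then {c f g : Prog} {x v y : Data} {s t : ℕ} :
      Runs c x v s → v ≠ Data.nil → Runs f x y t → Runs (Prog.cond c f g) x y (s + t + 1)
  | cond_else {c f g : Prog} {x y : Data} {s t : ℕ} :
      Runs c x Data.nil s → Runs g x y t → Runs (Prog.cond c f g) x y (s + t + 1)
  | loop_stop {c f : Prog} {x : Data} {s : ℕ} :
      Runs c x Data.nil s → Runs (Prog.loop c f) x x (s + 1)
  | loop_step {c f : Prog} {x v y z : Data} {s t u : ℕ} :
      Runs c x v s → v ≠ Data.nil → Runs f x y t → Runs (Prog.loop c f) y z u →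
      Runs (Prog.loop c f) x z (s + t + u + 1)

/-! ### Minimization problems and approximation algorithms -/

/-- A minimization problem, with encodings of its instances and candidate solutions. -/
structure MinProblem where
  /-- the instances -/
  Inst : Type
  /-- the candidate solutions of an instance -/
  Sol : Inst → Type
  /-- the input given to an algorithm -/
  encodeInst : Inst → Data
  /-- the output expected from an algorithm -/
  encodeSol : (I : Inst) → Sol I → Data
  /-- the feasible solutions -/
  Feasible : (I : Inst) → Sol I → Prop
  /-- the quantity to minimize -/
  cost : (I : Inst) → Sol I → ℚ

/-- The same problem on the instances that satisfy `p` only. -/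
def MinProblem.restrict (P : MinProblem) (p : P.Inst → Prop) : MinProblem where
  Inst := {I : P.Inst // p I}
  Sol I := P.Sol I.1
  encodeInst I := P.encodeInst I.1
  encodeSol I := P.encodeSol I.1
  Feasible I := P.Feasible I.1
  cost I := P.cost I.1

/-- `P` has a polynomial-time approximation algorithm of ratio `ρ`: on each instance `I` a fixed
program outputs, in time polynomial in the length of the input, a feasible solution whose cost is
at most `ρ I` times the cost of any feasible solution, in particular of an optimal one. -/
def MinProblem.HasPolyTimeApprox (P : MinProblem) (ρ : P.Inst → ℝ) : Prop :=
  ∃ (p : Prog) (q : Polynomial ℕ), ∀ I : P.Inst, ∃ (s : P.Sol I) (t : ℕ),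
    Runs p (P.encodeInst I) (P.encodeSol I s) t ∧ t ≤ q.eval (P.encodeInst I).size ∧
    P.Feasible I s ∧
    ∀ s' : P.Sol I, P.Feasible I s' → (P.cost I s : ℝ) ≤ ρ I * (P.cost I s' : ℝ)

/-! ### Graphs -/

/-- A graph is chordal if it has no induced cycle of length four or more. -/
def IsChordal {V : Type*} (G : SimpleGraph V) : Prop :=
  ∀ k : ℕ, 4 ≤ k → IsEmpty (SimpleGraph.cycleGraph k ↪g G)

/-- The distance between two edges: the least distance between an end of the first and an end of
the second (infinite if they lie in different components). -/
noncomputable def edgeDist {V : Type*} (G : SimpleGraph V) (e f : Sym2 V) : ℕ∞ :=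
  ⨅ u ∈ e, ⨅ v ∈ f, G.edist u v

/-- A distance-`k` matching: a set of edges whose pairwise distances are at least `k`. -/
def IsDistMatching {V : Type*} (G : SimpleGraph V) (k : ℕ) (M : Finset (Sym2 V)) : Prop :=
  (∀ e ∈ M, e ∈ G.edgeSet) ∧ ∀ e ∈ M, ∀ f ∈ M, e ≠ f → (k : ℕ∞) ≤ edgeDist G e f

/-- A finite graph with positive rational edge weights (values of `w` off the edges are unused). -/
structure WeightedGraph where
  /-- the number of vertices -/
  n : ℕ
  /-- the graph -/
  G : SimpleGraph (Fin n)
  /-- the weights -/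
  w : Sym2 (Fin n) → ℚ
  w_pos : ∀ e ∈ G.edgeSet, 0 < w e

open Classical in
/-- The weighted adjacency matrix, row by row: `nil` for a non-edge, the weight for an edge. -/
noncomputable def WeightedGraph.encode (I : WeightedGraph) : Data :=
  Data.ofList (List.ofFn fun i : Fin I.n => Data.ofList (List.ofFn fun j : Fin I.n =>
    if I.G.Adj i j then Data.ofRat (I.w s(i, j)) else Data.nil))

/-- Weighted Minimum Maximal Distance-`k` Matching. The output is the `0`-`1` matrix of the
matching. -/
noncomputable def WMMM (k : ℕ) : MinProblem where
  Inst := WeightedGraph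
  Sol I := Finset (Sym2 (Fin I.n))
  encodeInst := WeightedGraph.encode
  encodeSol I M := Data.ofList (List.ofFn fun i : Fin I.n => Data.ofList (List.ofFn
    fun j : Fin I.n => Data.ofBool (decide (s(i, j) ∈ M))))
  Feasible I M := Maximal (IsDistMatching I.G k) M
  cost I M := ∑ e ∈ M, I.w e

/-! ### Set Cover -/

/-- A universe `X` of `n` elements and a family `S` of `m` subsets that covers it. -/
structure SetCoverInstance where
  /-- the number of elements -/
  n : ℕ
  /-- the number of sets -/
  m : ℕ
  /-- the sets -/
  S : Fin m → Finset (Fin n)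
  covers : ∀ x, ∃ i, x ∈ S i

/-- The number of elements in unary, and the incidence matrix, set by set. -/
def SetCoverInstance.encode (I : SetCoverInstance) : Data :=
  Data.cons (Data.ofUnary I.n) (Data.ofList (List.ofFn fun i : Fin I.m =>
    Data.ofList (List.ofFn fun x : Fin I.n => Data.ofBool (decide (x ∈ I.S i)))))

/-- Set Cover: choose as few sets of the family as possible that still cover. The output is the
`0`-`1` vector of the chosen indices. -/
def SetCover : MinProblem where
  Inst := SetCoverInstance
  Sol I := Finset (Fin I.m)
  encodeInst := SetCoverInstance.encode
  encodeSol I D := Data.ofList (List.ofFn fun i : Fin I.m => Data.ofBool (decide (i ∈ D)))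
  Feasible I D := ∀ x : Fin I.n, ∃ i ∈ D, x ∈ I.S i
  cost _ D := D.card

/-! The reduction. Put `l = p + 1`. From a set cover instance with elements `x` and sets `i`, build a
graph in which the elements form a clique, each element is joined to the sets that contain it, and a
path hangs from each element and from each set. The vertices are numbered by a level (the place on
the path) and a column (an element or a set). Removing the paths from their far ends, then the sets,
then the elements is a perfect elimination ordering, so the graph is chordal (`isChordal_graph`).

On the path of the set `i`, the edge between the levels `p` and `p + 1` (`chosenEdge`) has weight
`1`, and the next edge (`spareEdge`) has the tiny weight `2 ^ (-k)`; all other edges have the huge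
weight `2 ^ k`. Chosen and spare edges of different sets are at distance at least `2 * l`, and the
last edge of the path of `x` (`probeEdge`) is at distance less than `2 * l` from the chosen edge of
`i` exactly if `x` belongs to `i`, and from no spare edge. Hence a maximal matching that avoids the
huge edges chooses a cover (`cover_of_maximal`), and conversely a cover, completed by the spare edges
of the sets left out, is a maximal matching (`maximal_matchingOf`) whose cost exceeds the size of the
cover by at most `m * 2 ^ (-k)`. The lower bounds on distances come from a `1`-Lipschitz function
(`potential`).

The ratio. If `m ≤ n ^ d` and `n ≥ 4 * (p + 3)`, the graph has at most `n ^ (d + 1) / 2` vertices, so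
that `c * log |V|` is smaller than `c * (d + 1) * log n` by at least `c * log 2`, which pays for the
spare edges; when the ratio is `1`, integrality does (`coverOf_approx`). The finitely many instances
with smaller `n` are solved by a table (`PolyTime.of_finite_compl`).

Polynomial time. `PolyTime N g f` says that one program takes `g i` to `f i` in time polynomial in
`N i`, for all indices `i`. This relation is closed under composition, pairing, case distinction and
the usual list operations, and the construction of the weighted adjacency matrix
(`polyTime_weightedGraph`) and the decoding (`polyTime_coverOf`) are assembled from these. As a
program may produce a tree of size exponential in its running time, the length of the input passed to
the given algorithm is bounded separately (`polyBounded_size_weightedGraph`). -/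

/-! ### Polynomial bounds -/

/-- `M` is bounded by a polynomial in `N`, uniformly over the index type. -/
def PolyBounded {ι : Type} (N M : ι → ℕ) : Prop :=
  ∃ q : Polynomial ℕ, ∀ i, M i ≤ q.eval (N i)

lemma Polynomial.eval_le_eval_of_le (q : Polynomial ℕ) {a b : ℕ} (h : a ≤ b) :
    q.eval a ≤ q.eval b := by
  rw [Polynomial.eval_eq_sum, Polynomial.eval_eq_sum]
  exact Finset.sum_le_sum fun i _ => Nat.mul_le_mul_left _ (Nat.pow_le_pow_left h _)

namespace PolyBounded

variable {ι κ : Type} {N M M' : ι → ℕ}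

lemma mono (h : PolyBounded N M') (hM : ∀ i, M i ≤ M' i) : PolyBounded N M := by
  obtain ⟨q, hq⟩ := h
  exact ⟨q, fun i => (hM i).trans (hq i)⟩

lemma const (c : ℕ) : PolyBounded N fun _ => c := ⟨Polynomial.C c, fun i => by simp⟩

lemma refl : PolyBounded N N := ⟨Polynomial.X, fun i => by simp⟩

lemma add (h : PolyBounded N M) (h' : PolyBounded N M') :
    PolyBounded N fun i => M i + M' i := by
  obtain ⟨q, hq⟩ := h
  obtain ⟨q', hq'⟩ := h'
  exact ⟨q + q', fun i => by simpa using Nat.add_le_add (hq i) (hq' i)⟩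

lemma mul (h : PolyBounded N M) (h' : PolyBounded N M') :
    PolyBounded N fun i => M i * M' i := by
  obtain ⟨q, hq⟩ := h
  obtain ⟨q', hq'⟩ := h'
  exact ⟨q * q', fun i => by simpa using Nat.mul_le_mul (hq i) (hq' i)⟩

lemma comap (h : PolyBounded N M) (φ : κ → ι) :
    PolyBounded (fun j => N (φ j)) fun j => M (φ j) := by
  obtain ⟨q, hq⟩ := h
  exact ⟨q, fun j => hq (φ j)⟩

end PolyBounded

/-! ### Polynomial-time computability -/

/-- A single program takes `g i` to `f i` for every index `i`, in time polynomial in `N i`. The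
size parameter `N` is kept apart from the input `g`, so that `PolyTime N` composes without any
bound on the sizes of intermediate results (a program can double the size of its value in one
step). -/
def PolyTime {ι : Type} (N : ι → ℕ) (g f : ι → Data) : Prop :=
  ∃ p : Prog, ∃ q : Polynomial ℕ, ∀ i, ∃ t, Runs p (g i) (f i) t ∧ t ≤ q.eval (N i)

/-- A property of the index that can be decided from `g i` in time polynomial in `N i`: some
polynomial-time value is nonempty exactly when the property holds. -/
def PolyDec {ι : Type} (N : ι → ℕ) (g : ι → Data) (P : ι → Prop) : Prop :=
  ∃ c : ι → Data, PolyTime N g c ∧ ∀ i, c i ≠ Data.nil ↔ P i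

namespace PolyTime

variable {ι κ : Type} {N : ι → ℕ} {g f f' h : ι → Data}

lemma congr (hf : PolyTime N g f) (e : ∀ i, f i = f' i) : PolyTime N g f' := by
  obtain rfl : f = f' := funext e
  exact hf

lemma of_prog (p : Prog) (h : ∀ i, Runs p (g i) (f i) 1) : PolyTime N g f :=
  ⟨p, 1, fun i => ⟨1, h i, by simp⟩⟩

lemma refl : PolyTime N g g := of_prog Prog.id fun _ => Runs.id _

lemma nil : PolyTime N g fun _ => Data.nil := of_prog Prog.nil fun _ => Runs.nil _

lemma comp (h₁ : PolyTime N g f) (h₂ : PolyTime N f h) : PolyTime N g h := by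
  obtain ⟨p, q, hp⟩ := h₁
  obtain ⟨p', q', hp'⟩ := h₂
  refine ⟨Prog.comp p' p, q + q' + 1, fun i => ?_⟩
  obtain ⟨t, ht, hq⟩ := hp i
  obtain ⟨t', ht', hq'⟩ := hp' i
  exact ⟨_, Runs.comp ht ht', by simp; omega⟩

lemma cons (h₁ : PolyTime N g f) (h₂ : PolyTime N g h) :
    PolyTime N g fun i => Data.cons (f i) (h i) := by
  obtain ⟨p, q, hp⟩ := h₁
  obtain ⟨p', q', hp'⟩ := h₂
  refine ⟨Prog.cons p p', q + q' + 1, fun i => ?_⟩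
  obtain ⟨t, ht, hq⟩ := hp i
  obtain ⟨t', ht', hq'⟩ := hp' i
  exact ⟨_, Runs.cons ht ht', by simp; omega⟩

lemma head (h₁ : PolyTime N g f) : PolyTime N g fun i => (f i).head :=
  h₁.comp (of_prog Prog.head fun _ => Runs.head _)

lemma tail (h₁ : PolyTime N g f) : PolyTime N g fun i => (f i).tail :=
  h₁.comp (of_prog Prog.tail fun _ => Runs.tail _)

lemma fst (h₁ : PolyTime N g fun i => Data.cons (f i) (h i)) : PolyTime N g f := h₁.head

lemma snd (h₁ : PolyTime N g fun i => Data.cons (f i) (h i)) : PolyTime N g h := h₁.tail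

lemma const (d : Data) : PolyTime N g fun _ => d := by
  induction d with
  | nil => exact nil
  | cons a b ha hb => exact ha.cons hb

lemma comap (h₁ : PolyTime N g f) (φ : κ → ι) :
    PolyTime (fun j => N (φ j)) (fun j => g (φ j)) fun j => f (φ j) := by
  obtain ⟨p, q, hp⟩ := h₁
  exact ⟨p, q, fun j => hp (φ j)⟩

lemma mono {N' : ι → ℕ} (h₁ : PolyTime N' g f) (hN : PolyBounded N N') : PolyTime N g f := by
  obtain ⟨p, q, hp⟩ := h₁
  obtain ⟨r, hr⟩ := hN
  refine ⟨p, q.comp r, fun i => ?_⟩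
  obtain ⟨t, ht, hq⟩ := hp i
  exact ⟨t, ht, by simpa using hq.trans (q.eval_le_eval_of_le (hr i))⟩

/-- Each branch only has to work on the indices that reach it. -/
lemma cond {P : ι → Prop} (hP : PolyDec N g P)
    (h₁ : PolyTime (ι := {i // P i}) (fun i => N i) (fun i => g i) fun i => f i)
    (h₂ : PolyTime (ι := {i // ¬ P i}) (fun i => N i) (fun i => g i) fun i => f i) :
    PolyTime N g f := by
  obtain ⟨c, ⟨p₀, q₀, h₀⟩, hc⟩ := hP
  obtain ⟨p, q, hp⟩ := h₁
  obtain ⟨p', q', hp'⟩ := h₂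
  refine ⟨Prog.cond p₀ p p', q₀ + q + q' + 1, fun i => ?_⟩
  obtain ⟨t₀, ht₀, hq₀⟩ := h₀ i
  by_cases hi : P i
  · obtain ⟨t, ht, hq⟩ := hp ⟨i, hi⟩
    exact ⟨_, Runs.cond_then ht₀ ((hc i).2 hi) ht, by simp at hq ⊢; omega⟩
  · obtain ⟨t, ht, hq⟩ := hp' ⟨i, hi⟩
    have hn : c i = Data.nil := by
      by_contra hne
      exact hi ((hc i).1 hne)
    rw [hn] at ht₀
    exact ⟨_, Runs.cond_else ht₀ ht, by simp at hq ⊢; omega⟩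

lemma ite {P : ι → Prop} (hP : PolyDec N g P) (hf : PolyTime N g f) (hh : PolyTime N g h)
    (e₁ : ∀ i, P i → f' i = f i) (e₂ : ∀ i, ¬ P i → f' i = h i) : PolyTime N g f' :=
  cond hP ((hf.comap Subtype.val).congr fun i => (e₁ i i.2).symm)
    ((hh.comap Subtype.val).congr fun i => (e₂ i i.2).symm)

/-- A loop that passes through the states `st i 0, …, st i (k i)`, with `k` polynomially bounded.
The test `c i j` is the one on the state `st i j`. -/
lemma loop {st c : ι → ℕ → Data} {k : ι → ℕ} (hk : PolyBounded N k)
    (hc : PolyTime (ι := {x : ι × ℕ // x.2 ≤ k x.1}) (fun x => N x.1.1)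
      (fun x => st x.1.1 x.1.2) fun x => c x.1.1 x.1.2)
    (hlt : ∀ i j, j < k i → c i j ≠ Data.nil) (hend : ∀ i, c i (k i) = Data.nil)
    (hf : PolyTime (ι := {x : ι × ℕ // x.2 < k x.1}) (fun x => N x.1.1)
      (fun x => st x.1.1 x.1.2) fun x => st x.1.1 (x.1.2 + 1)) :
    PolyTime N (fun i => st i 0) fun i => st i (k i) := by
  obtain ⟨qk, hqk⟩ := hk
  obtain ⟨p, q, hp⟩ := hc
  obtain ⟨p', q', hp'⟩ := hf
  refine ⟨Prog.loop p p', (qk + 1) * (q + q' + 1), fun i => ?_⟩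
  have key : ∀ r j, j + r = k i → ∃ t, Runs (Prog.loop p p') (st i j) (st i (k i)) t ∧
      t ≤ (r + 1) * (q.eval (N i) + q'.eval (N i) + 1) := by
    intro r
    induction r with
    | zero =>
      intro j hj
      obtain rfl : j = k i := by omega
      obtain ⟨t, ht, hq⟩ := hp ⟨(i, k i), le_rfl⟩
      simp only [hend] at ht
      exact ⟨_, Runs.loop_stop ht, by simp only at hq; omega⟩
    | succ r ih =>
      intro j hj
      have hjk : j < k i := by omega
      obtain ⟨t, ht, hq⟩ := hp ⟨(i, j), hjk.le⟩
      obtain ⟨t', ht', hq'⟩ := hp' ⟨(i, j), hjk⟩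
      obtain ⟨t'', ht'', hq''⟩ := ih (j + 1) (by omega)
      refine ⟨_, Runs.loop_step ht (hlt i j hjk) ht' ht'', ?_⟩
      rw [Nat.succ_mul]
      simp only at hq hq'
      omega
  obtain ⟨t, ht, hq⟩ := key (k i) 0 (by omega)
  refine ⟨t, ht, hq.trans ?_⟩
  simp only [Polynomial.eval_mul, Polynomial.eval_add, Polynomial.eval_one]
  exact Nat.mul_le_mul_right _ (Nat.add_le_add_right (hqk i) 1)

end PolyTime

namespace PolyDec

variable {ι κ : Type} {N : ι → ℕ} {g f : ι → Data} {P Q : ι → Prop}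

lemma congr (h : PolyDec N g P) (e : ∀ i, P i ↔ Q i) : PolyDec N g Q := by
  obtain ⟨c, hc, hP⟩ := h
  exact ⟨c, hc, fun i => (hP i).trans (e i)⟩

lemma of_ne_nil (h : PolyTime N g f) : PolyDec N g fun i => f i ≠ Data.nil :=
  ⟨f, h, fun _ => Iff.rfl⟩

lemma const (p : Prop) : PolyDec N g fun _ => p := by
  by_cases h : p
  · exact ⟨fun _ => Data.cons Data.nil Data.nil, PolyTime.const _, by simp [h]⟩
  · exact ⟨fun _ => Data.nil, PolyTime.const _, by simp [h]⟩

lemma ite {R : ι → Prop} (hP : PolyDec N g P) (hQ : PolyDec N g Q) (hR : PolyDec N g R) :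
    PolyDec N g fun i => (P i ∧ Q i) ∨ (¬ P i ∧ R i) := by
  classical
  obtain ⟨c, hc, hcQ⟩ := hQ
  obtain ⟨c', hc', hcR⟩ := hR
  refine ⟨fun i => if P i then c i else c' i, PolyTime.ite hP hc hc' (fun i h => if_pos h)
    fun i h => if_neg h, fun i => ?_⟩
  by_cases h : P i <;> simp [h, hcQ, hcR]

lemma not (hP : PolyDec N g P) : PolyDec N g fun i => ¬ P i :=
  (hP.ite (const False) (const True)).congr fun i => by tauto

lemma and (hP : PolyDec N g P) (hQ : PolyDec N g Q) : PolyDec N g fun i => P i ∧ Q i :=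
  (hP.ite hQ (const False)).congr fun i => by tauto

lemma or (hP : PolyDec N g P) (hQ : PolyDec N g Q) : PolyDec N g fun i => P i ∨ Q i :=
  (hP.ite (const True) hQ).congr fun i => by tauto

end PolyDec

/-! ### List operations in polynomial time -/

namespace Data

@[simp] lemma ofList_nil : ofList [] = nil := rfl

@[simp] lemma ofList_cons (a : Data) (L : List Data) : ofList (a :: L) = cons a (ofList L) := rfl

@[simp] lemma head_cons (a b : Data) : (cons a b).head = a := rfl

@[simp] lemma tail_cons (a b : Data) : (cons a b).tail = b := rfl

@[simp] lemma ofList_eq_nil {L : List Data} : ofList L = nil ↔ L = [] := by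
  cases L <;> simp

lemma tail_ofList (L : List Data) : (ofList L).tail = ofList L.tail := by
  cases L <;> rfl

lemma head_ofList (L : List Data) : (ofList L).head = L.headD nil := by
  cases L <;> rfl

lemma head_ofList_drop (L : List Data) (k : ℕ) : (ofList (L.drop k)).head = L.getD k nil := by
  simp [head_ofList, List.headD_eq_head?_getD, List.getD_eq_getElem?_getD]

lemma ofUnary_succ (n : ℕ) : ofUnary (n + 1) = cons nil (ofUnary n) := rfl

lemma ofList_injective : Function.Injective ofList := by
  intro L
  induction L with
  | nil => intro L'; cases L' <;> simp
  | cons a L ih =>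
    intro L'
    cases L' with
    | nil => simp
    | cons b L' =>
      intro h
      simp only [ofList_cons, cons.injEq] at h
      rw [h.1, ih h.2]

lemma ofUnary_injective : Function.Injective ofUnary := by
  intro a b h
  simpa using congrArg List.length (ofList_injective h)

lemma ofBool_ne_nil {b : Bool} : ofBool b ≠ nil ↔ b = true := by
  cases b <;> simp [ofBool]

lemma ofBool_injective : Function.Injective ofBool := by
  intro a b h
  cases a <;> cases b <;> simp_all [ofBool]

end Data

namespace PolyTime

variable {ι : Type} {N : ι → ℕ} {g env : ι → Data}

/-- Dropping from one list as many entries as another list has. -/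
lemma drop {A B : ι → List Data} (hA : PolyTime N g fun i => Data.ofList (A i))
    (hB : PolyTime N g fun i => Data.ofList (B i)) (hb : PolyBounded N fun i => (B i).length) :
    PolyTime N g fun i => Data.ofList ((A i).drop (B i).length) := by
  have key := loop (N := N)
    (st := fun i j => Data.cons (Data.ofList ((A i).drop j)) (Data.ofList ((B i).drop j)))
    (c := fun i j => Data.ofList ((B i).drop j)) hb refl.snd
    (fun i j hj => by simpa using hj) (fun i => by simp)
    ((refl.fst.tail.cons refl.snd.tail).congr fun x => by
      simp [Data.tail_ofList, List.tail_drop])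
  exact ((hA.cons hB).comp key).fst

/-- One pass over a list that applies a program to each entry, with a fixed environment, and pushes
the results onto an accumulator. -/
lemma revMapAppend {κ : ι → Type} {L : (i : ι) → List (κ i)} {enc out : (i : ι) → κ i → Data}
    {acc : ι → List Data} (henv : PolyTime N g env)
    (hL : PolyTime N g fun i => Data.ofList ((L i).map (enc i)))
    (hacc : PolyTime N g fun i => Data.ofList (acc i))
    (hb : PolyBounded N fun i => (L i).length)
    (hf : PolyTime (ι := Σ i, κ i) (fun x => N x.1)
      (fun x => Data.cons (env x.1) (enc x.1 x.2)) fun x => out x.1 x.2) :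
    PolyTime N g fun i => Data.ofList (((L i).map (out i)).reverse ++ acc i) := by
  have key := loop (N := N)
    (st := fun i j => Data.cons (Data.ofList (((L i).drop j).map (enc i)))
      (Data.cons (env i) (Data.ofList ((((L i).take j).map (out i)).reverse ++ acc i))))
    (c := fun i j => Data.ofList (((L i).drop j).map (enc i))) hb refl.fst
    (fun i j hj => by simpa using hj) (fun i => by simp)
    (by
      have body := hf.comap fun x : {x : ι × ℕ // x.2 < (L x.1).length} =>
        (⟨x.1.1, (L x.1.1)[x.1.2]'x.2⟩ : Σ i, κ i)
      refine PolyTime.congr (refl.fst.tail.cons (refl.snd.fst.cons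
        (((refl.snd.fst.cons refl.fst.head).congr fun x => ?_).comp body |>.cons
          refl.snd.snd))) fun x => ?_
      · rw [List.drop_eq_getElem_cons x.2, List.map_cons, Data.ofList_cons, Data.head_cons]
      · simp only [Data.tail_ofList, ← List.map_tail, List.tail_drop]
        rw [List.take_add_one, List.getElem?_eq_getElem x.2, Option.toList_some,
          List.map_append, List.reverse_append, List.map_singleton, List.reverse_singleton,
          List.append_assoc, List.singleton_append, Data.ofList_cons])
  exact (((hL.cons (henv.cons hacc)).comp key).snd.snd).congr fun i => by simp

lemma reverse {A : ι → List Data} (hA : PolyTime N g fun i => Data.ofList (A i))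
    (hb : PolyBounded N fun i => (A i).length) :
    PolyTime N g fun i => Data.ofList (A i).reverse :=
  (revMapAppend (κ := fun _ => Data) (L := A) (enc := fun _ => _root_.id)
    (out := fun _ => _root_.id)
    (acc := fun _ => []) nil (by simpa using hA) nil hb refl.snd).congr fun i => by simp

lemma append {A B : ι → List Data} (hA : PolyTime N g fun i => Data.ofList (A i))
    (hB : PolyTime N g fun i => Data.ofList (B i)) (hb : PolyBounded N fun i => (A i).length) :
    PolyTime N g fun i => Data.ofList (A i ++ B i) :=
  (revMapAppend (κ := fun _ => Data) (L := fun i => (A i).reverse) (enc := fun _ => _root_.id)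
    (out := fun _ => _root_.id) nil (by simpa using hA.reverse hb) hB (by simpa using hb)
    refl.snd).congr fun i => by simp

lemma map {κ : ι → Type} {L : (i : ι) → List (κ i)} {enc out : (i : ι) → κ i → Data}
    (henv : PolyTime N g env) (hL : PolyTime N g fun i => Data.ofList ((L i).map (enc i)))
    (hb : PolyBounded N fun i => (L i).length)
    (hf : PolyTime (ι := Σ i, κ i) (fun x => N x.1)
      (fun x => Data.cons (env x.1) (enc x.1 x.2)) fun x => out x.1 x.2) :
    PolyTime N g fun i => Data.ofList ((L i).map (out i)) :=
  ((revMapAppend (acc := fun _ => []) henv hL nil hb hf).reverse (by simpa using hb)).congr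
    fun i => by simp

/-- Concatenation of a fixed number of lists. -/
lemma flatten_ofFn {q : ℕ} {F : Fin q → ι → List Data}
    (hF : ∀ r, PolyTime N g fun i => Data.ofList (F r i))
    (hb : ∀ r, PolyBounded N fun i => (F r i).length) :
    PolyTime N g fun i => Data.ofList (List.ofFn fun r => F r i).flatten := by
  induction q with
  | zero => exact nil.congr fun i => by simp
  | succ q ih =>
    exact ((hF 0).append (ih (F := fun r => F r.succ) (fun r => hF _) fun r => hb _)
      (hb 0)).congr fun i => by simp [List.ofFn_succ]

lemma drop_mul {A B : ι → List Data} (q : ℕ) (hA : PolyTime N g fun i => Data.ofList (A i))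
    (hB : PolyTime N g fun i => Data.ofList (B i)) (hb : PolyBounded N fun i => (B i).length) :
    PolyTime N g fun i => Data.ofList ((A i).drop (q * (B i).length)) := by
  induction q with
  | zero => simpa using hA
  | succ q ih =>
    exact (ih.drop hB hb).congr fun i => by rw [List.drop_drop, Nat.succ_mul]

/-- The unary numbers below the length of a list. -/
lemma ofUnary_range {k : ι → ℕ} (hk : PolyTime N g fun i => Data.ofUnary (k i))
    (hb : PolyBounded N k) :
    PolyTime N g fun i => Data.ofList (List.ofFn fun x : Fin (k i) => Data.ofUnary x) := by
  have key := loop (N := N)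
    (st := fun i j => Data.cons (Data.ofUnary (k i - j))
      (Data.ofList ((List.range' (k i - j) (min j (k i))).map Data.ofUnary)))
    (c := fun i j => Data.ofUnary (k i - j)) hb refl.fst
    (fun i j hj => by
      obtain ⟨r, hr⟩ : ∃ r, k i - j = r + 1 := ⟨k i - j - 1, by omega⟩
      simp [hr, Data.ofUnary_succ])
    (fun i => by simp [Data.ofUnary])
    ((refl.fst.tail.cons (refl.fst.tail.cons refl.snd)).congr fun x => by
      have hx := x.2
      obtain ⟨r, hr⟩ : ∃ r, k x.1.1 - x.1.2 = r + 1 := ⟨k x.1.1 - x.1.2 - 1, by omega⟩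
      have hr' : k x.1.1 - (x.1.2 + 1) = r := by omega
      rw [hr, hr', min_eq_left (show x.1.2 ≤ k x.1.1 by omega),
        min_eq_left (show x.1.2 + 1 ≤ k x.1.1 by omega), List.range'_succ]
      simp [Data.ofUnary_succ])
  refine (((hk.cons nil).congr fun i => ?_).comp key).snd.congr fun i => ?_
  · simp
  · congr 1
    apply List.ext_getElem <;> simp

end PolyTime

/-! ### Chordality and distances from orderings and potentials -/

/-- A graph is chordal if it has a perfect elimination ordering: here ties in the rank are allowed,
and the neighbours of rank at least that of a vertex form a clique. -/
lemma IsChordal.of_rank {V : Type*} {G : SimpleGraph V} (rank : V → ℕ)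
    (h : ∀ v u u', G.Adj v u → G.Adj v u' → rank v ≤ rank u → rank v ≤ rank u' → u ≠ u' →
      G.Adj u u') : IsChordal G := by
  intro k hk
  refine ⟨fun c => ?_⟩
  obtain ⟨n, rfl⟩ : ∃ n, k = n + 4 := ⟨k - 4, by omega⟩
  obtain ⟨i, -, hi⟩ := Finset.exists_min_image Finset.univ (fun i => rank (c i))
    ⟨0, Finset.mem_univ _⟩
  have h1 : (1 : Fin (n + 4)) ≠ 0 := by simp
  have h2 : (1 + 1 : Fin (n + 4)) ≠ 0 := by
    simp [Fin.ext_iff, Fin.val_add, Nat.mod_eq_of_lt]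
  have h3 : (1 + 1 + 1 : Fin (n + 4)) ≠ 0 := by
    simp [Fin.ext_iff, Fin.val_add, Nat.mod_eq_of_lt]
  have hne : i + 1 ≠ i - 1 := fun he => h2 <| by
    rw [← sub_eq_zero.2 he]; abel
  have hadj := h (c i) (c (i + 1)) (c (i - 1))
    (c.map_rel_iff.2 (by rw [SimpleGraph.cycleGraph_adj]; right; abel))
    (c.map_rel_iff.2 (by rw [SimpleGraph.cycleGraph_adj]; left; abel))
    (hi _ (Finset.mem_univ _)) (hi _ (Finset.mem_univ _)) (c.injective.ne hne)
  have hadj' := c.map_rel_iff.1 hadj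
  rw [SimpleGraph.cycleGraph_adj] at hadj'
  rcases hadj' with he | he
  · refine h1 ?_
    rw [← sub_eq_zero.2 he]; abel
  · refine h3 ?_
    rw [← sub_eq_zero.2 he.symm]; abel

/-- A function that grows by at most one along each edge bounds distances from below. -/
lemma SimpleGraph.le_add_edist_of_adj_le {V : Type*} {G : SimpleGraph V} (φ : V → ℕ)
    (h : ∀ u v, G.Adj u v → φ v ≤ φ u + 1) (u v : V) : (φ v : ℕ∞) ≤ φ u + G.edist u v := by
  have key : ∀ {u v : V} (w : G.Walk u v), φ v ≤ φ u + w.length := by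
    intro u v w
    induction w with
    | nil => simp
    | cons hadj w ih =>
      have := h _ _ hadj
      rw [SimpleGraph.Walk.length_cons]
      omega
  by_cases hr : G.edist u v = ⊤
  · simp [hr]
  · obtain ⟨w, hw⟩ := SimpleGraph.exists_walk_of_edist_ne_top hr
    rw [← hw]
    exact_mod_cast key w

lemma le_edgeDist_iff {V : Type*} {G : SimpleGraph V} {e f : Sym2 V} {k : ℕ∞} :
    k ≤ edgeDist G e f ↔ ∀ u ∈ e, ∀ v ∈ f, k ≤ G.edist u v := by
  simp [edgeDist]

lemma edgeDist_comm {V : Type*} (G : SimpleGraph V) (e f : Sym2 V) :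
    edgeDist G e f = edgeDist G f e := by
  apply le_antisymm <;> rw [le_edgeDist_iff] <;> intro u hu v hv <;>
    rw [SimpleGraph.edist_comm] <;> exact le_edgeDist_iff.1 le_rfl v hv u hu

/-! ### The graph of a set cover instance -/

namespace SetCoverInstance

variable (I : SetCoverInstance) (p : ℕ)

/-- Adjacency at level zero, each edge in one direction: the elements form a clique, and an element
is joined to the sets that contain it. -/
def Link : Fin I.n ⊕ Fin I.m → Fin I.n ⊕ Fin I.m → Prop
  | .inl x, .inl y => x < y
  | .inl x, .inr i => x ∈ I.S i
  | .inr _, _ => False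

/-- The edges of the graph, each in one direction: the links at level zero, and a path that hangs
from each element and each set. The path of an element ends at level `p + 1`, that of a set at level
`p + 2`; the node of an element at level `p + 2` is isolated and makes the vertex set a product. -/
def Arc (a b : Fin (p + 3) × (Fin I.n ⊕ Fin I.m)) : Prop :=
  (a.1.val = 0 ∧ b.1.val = 0 ∧ I.Link a.2 b.2) ∨
    (b.1.val = a.1.val + 1 ∧ a.2 = b.2 ∧ (a.2.isLeft → b.1.val ≤ p + 1))

/-- The numbering of the vertices, level by level. -/
def node : Fin (p + 3) × (Fin I.n ⊕ Fin I.m) ≃ Fin ((p + 3) * (I.n + I.m)) :=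
  (Equiv.prodCongr (Equiv.refl _) finSumFinEquiv).trans finProdFinEquiv

/-- The chordal graph of a set cover instance. -/
def graph : SimpleGraph (Fin ((p + 3) * (I.n + I.m))) where
  Adj a b := I.Arc p ((I.node p).symm a) ((I.node p).symm b) ∨
    I.Arc p ((I.node p).symm b) ((I.node p).symm a)
  symm := ⟨fun _ _ h => h.symm⟩
  loopless := ⟨fun a h => by
    rcases h with (⟨-, -, h⟩ | ⟨h, -⟩) | (⟨-, -, h⟩ | ⟨h, -⟩)
    · rcases h' : ((I.node p).symm a).2 <;> simp [h', Link] at h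
    · omega
    · rcases h' : ((I.node p).symm a).2 <;> simp [h', Link] at h
    · omega⟩

variable {I p}

lemma adj_node {a b : Fin (p + 3) × (Fin I.n ⊕ Fin I.m)} :
    (I.graph p).Adj (I.node p a) (I.node p b) ↔ I.Arc p a b ∨ I.Arc p b a := by
  simp [graph]

lemma forall_node {P : Fin ((p + 3) * (I.n + I.m)) → Prop} :
    (∀ v, P v) ↔ ∀ a, P (I.node p a) :=
  (I.node p).surjective.forall

variable (I p)

/-- Deep path nodes come first in the elimination ordering, then the sets, then the elements. -/
lemma isChordal_graph : IsChordal (I.graph p) := by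
  refine IsChordal.of_rank (fun v => match (I.node p).symm v with
    | (r, .inl _) => p + 4 - r.val
    | (r, .inr _) => p + 3 - r.val) ?_
  simp only [forall_node, Equiv.symm_apply_apply, adj_node, ne_eq, EmbeddingLike.apply_eq_iff_eq]
  rintro ⟨r, v⟩ ⟨r₁, u⟩ ⟨r₂, u'⟩ h₁ h₂ hr₁ hr₂ hne
  have := r.2
  have := r₁.2
  have := r₂.2
  rcases v with x | i <;> rcases u with y | j <;> rcases u' with z | k <;>
    simp only [Arc, Link, Prod.mk.injEq, Fin.ext_iff, Fin.lt_def, Sum.inl.injEq, Sum.inr.injEq,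
      reduceCtorEq, and_false, false_and, or_false, false_or, Sum.isLeft_inl, Sum.isLeft_inr,
      forall_true_left, not_false_eq_true, Bool.false_eq_true, false_implies, and_true]
      at * <;> omega

end SetCoverInstance

namespace SetCoverInstance

variable (I : SetCoverInstance) (p : ℕ)

/-- The edge that puts the set `i` into the cover: levels `p` and `p + 1` of its path. -/
def chosenEdge (i : Fin I.m) : Sym2 (Fin ((p + 3) * (I.n + I.m))) :=
  s(I.node p (⟨p, by omega⟩, .inr i), I.node p (⟨p + 1, by omega⟩, .inr i))

/-- The edge that leaves the set `i` out of the cover: levels `p + 1` and `p + 2` of its path. -/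
def spareEdge (i : Fin I.m) : Sym2 (Fin ((p + 3) * (I.n + I.m))) :=
  s(I.node p (⟨p + 1, by omega⟩, .inr i), I.node p (⟨p + 2, by omega⟩, .inr i))

/-- The last edge of the path of the element `x`. It is close to the chosen edges of the sets that
contain `x`, and far from every other chosen or spare edge. -/
def probeEdge (x : Fin I.n) : Sym2 (Fin ((p + 3) * (I.n + I.m))) :=
  s(I.node p (⟨p, by omega⟩, .inl x), I.node p (⟨p + 1, by omega⟩, .inl x))

/-- A lower bound for the distance to the vertex of the set `i` at level `p + 2`. -/
def potential (i : Fin I.m) : Fin (p + 3) × (Fin I.n ⊕ Fin I.m) → ℕ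
  | (r, .inl x) => p + 2 + r + if x ∈ I.S i then 1 else 2
  | (r, .inr j) => if j = i then p + 2 - r else p + 2 + r + 2

variable {I p}

lemma potential_le_of_arc (i : Fin I.m) {a b : Fin (p + 3) × (Fin I.n ⊕ Fin I.m)}
    (h : I.Arc p a b) : I.potential p i b ≤ I.potential p i a + 1 ∧
      I.potential p i a ≤ I.potential p i b + 1 := by
  obtain ⟨r, u⟩ := a
  obtain ⟨r', v⟩ := b
  have := r.2
  have := r'.2
  rcases h with ⟨h₁, h₂, h⟩ | ⟨h, rfl, -⟩
  · simp only at h₁ h₂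
    rcases u with x | j <;> rcases v with y | k <;> simp only [Link] at h <;>
      simp only [potential] <;> split_ifs <;> first | omega | (subst_vars; contradiction)
  · simp only at h
    rcases u with x | j <;> simp only [potential] <;> split_ifs <;> omega

/-- The distance from a vertex on the path of the set `i` is at least the increase of the potential,
which is `p + 2 - r` at level `r` of that path. -/
lemma potential_le_add_edist (i : Fin I.m) (r : Fin (p + 3))
    (b : Fin (p + 3) × (Fin I.n ⊕ Fin I.m)) :
    (I.potential p i b : ℕ∞) ≤
      ((p + 2 - r : ℕ) : ℕ∞) + (I.graph p).edist (I.node p (r, .inr i)) (I.node p b) := by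
  have := SimpleGraph.le_add_edist_of_adj_le (G := I.graph p)
    (fun v => I.potential p i ((I.node p).symm v)) (fun u v h => by
      rcases h with h | h
      · exact (potential_le_of_arc i h).1
      · exact (potential_le_of_arc i h).2) (I.node p (r, .inr i)) (I.node p b)
  simpa [potential] using this

lemma le_edist_of_le_potential {i : Fin I.m} {r : Fin (p + 3)} {k : ℕ}
    {b : Fin (p + 3) × (Fin I.n ⊕ Fin I.m)} (h : k + (p + 2 - r) ≤ I.potential p i b) :
    (k : ℕ∞) ≤ (I.graph p).edist (I.node p (r, .inr i)) (I.node p b) := by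
  have h₁ := potential_le_add_edist i r b
  rcases eq_or_ne ((I.graph p).edist (I.node p (r, .inr i)) (I.node p b)) ⊤ with h₂ | h₂
  · simp [h₂]
  · obtain ⟨e, he⟩ := ENat.ne_top_iff_exists.1 h₂
    rw [← he] at h₁ ⊢
    norm_cast at h₁ ⊢
    omega

lemma edist_path_le (u : Fin I.n ⊕ Fin I.m) {a b : ℕ} (hab : a ≤ b) (hb : b < p + 3)
    (hu : u.isLeft → b ≤ p + 1) :
    (I.graph p).edist (I.node p (⟨a, by omega⟩, u)) (I.node p (⟨b, hb⟩, u)) ≤ ((b - a : ℕ) : ℕ∞) := by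
  induction b, hab using Nat.le_induction with
  | base => simp
  | succ b hab ih =>
    have hadj : (I.graph p).Adj (I.node p (⟨b, by omega⟩, u)) (I.node p (⟨b + 1, hb⟩, u)) :=
      adj_node.2 (Or.inl (Or.inr ⟨rfl, rfl, hu⟩))
    have := ih (by omega) (fun h => by have := hu h; omega)
    calc _ ≤ _ := SimpleGraph.edist_triangle (v := I.node p (⟨b, by omega⟩, u))
      _ ≤ ((b - a : ℕ) : ℕ∞) + 1 :=
        add_le_add this (SimpleGraph.edist_eq_one_iff_adj.2 hadj).le
      _ = _ := by norm_cast; omega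

/-- The vertices of the path of an element are close to the chosen edge of a set that covers it. -/
lemma edist_elem_set_le {x : Fin I.n} {i : Fin I.m} (h : x ∈ I.S i) {r : ℕ} (hr : r ≤ p) :
    (I.graph p).edist (I.node p (⟨r, by omega⟩, .inl x)) (I.node p (⟨p, by omega⟩, .inr i)) ≤
      ((2 * p + 1 : ℕ) : ℕ∞) := by
  have h₁ := edist_path_le (p := p) (I := I) (.inl x) (Nat.zero_le r) (by omega) (by omega)
  have h₂ := edist_path_le (p := p) (I := I) (.inr i) (Nat.zero_le p) (by omega) (by simp)
  have hadj : (I.graph p).Adj (I.node p (⟨0, by omega⟩, .inl x))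
      (I.node p (⟨0, by omega⟩, .inr i)) :=
    adj_node.2 (Or.inl (Or.inl ⟨rfl, rfl, h⟩))
  rw [SimpleGraph.edist_comm] at h₁
  calc _ ≤ _ := SimpleGraph.edist_triangle (v := I.node p (⟨0, by omega⟩, .inr i))
    _ ≤ _ := add_le_add_left (SimpleGraph.edist_triangle
      (v := I.node p (⟨0, by omega⟩, .inl x))) _
    _ ≤ ((r - 0 : ℕ) : ℕ∞) + 1 + ((p - 0 : ℕ) : ℕ∞) :=
      add_le_add (add_le_add h₁ (SimpleGraph.edist_eq_one_iff_adj.2 hadj).le) h₂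
    _ ≤ _ := by norm_cast; omega

lemma chosenEdge_mem (i : Fin I.m) : I.chosenEdge p i ∈ (I.graph p).edgeSet :=
  adj_node.2 (Or.inl (Or.inr ⟨rfl, rfl, by simp⟩))

lemma spareEdge_mem (i : Fin I.m) : I.spareEdge p i ∈ (I.graph p).edgeSet :=
  adj_node.2 (Or.inl (Or.inr ⟨rfl, rfl, by simp⟩))

lemma probeEdge_mem (x : Fin I.n) : I.probeEdge p x ∈ (I.graph p).edgeSet :=
  adj_node.2 (Or.inl (Or.inr ⟨rfl, rfl, by simp⟩))

lemma chosenEdge_injective : Function.Injective (I.chosenEdge p) := by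
  intro i j h
  simpa [chosenEdge] using h

lemma probeEdge_ne_chosenEdge (x : Fin I.n) (i : Fin I.m) :
    I.probeEdge p x ≠ I.chosenEdge p i := by
  simp [probeEdge, chosenEdge]

lemma probeEdge_ne_spareEdge (x : Fin I.n) (i : Fin I.m) :
    I.probeEdge p x ≠ I.spareEdge p i := by
  simp [probeEdge, spareEdge]

lemma le_edgeDist_spareEdge_probeEdge (x : Fin I.n) (i : Fin I.m) :
    ((2 * (p + 1) : ℕ) : ℕ∞) ≤ edgeDist (I.graph p) (I.spareEdge p i) (I.probeEdge p x) := by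
  simp only [le_edgeDist_iff, spareEdge, probeEdge, Sym2.mem_iff, forall_eq_or_imp, forall_eq]
  refine ⟨⟨?_, ?_⟩, ?_, ?_⟩ <;> apply le_edist_of_le_potential <;> simp only [potential] <;>
    split_ifs <;> omega

lemma le_edgeDist_chosenEdge_probeEdge {x : Fin I.n} {i : Fin I.m} (h : x ∉ I.S i) :
    ((2 * (p + 1) : ℕ) : ℕ∞) ≤ edgeDist (I.graph p) (I.chosenEdge p i) (I.probeEdge p x) := by
  simp only [le_edgeDist_iff, chosenEdge, probeEdge, Sym2.mem_iff, forall_eq_or_imp, forall_eq]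
  refine ⟨⟨?_, ?_⟩, ?_, ?_⟩ <;> apply le_edist_of_le_potential <;> simp only [potential, h] <;>
    simp only [if_false] <;> omega

/-! ### Covers and matchings -/

/-- A maximal matching without other edges than chosen and spare ones gives a cover: an element that
is not covered could be added to it as a probe edge. -/
lemma cover_of_maximal {M : Finset (Sym2 (Fin ((p + 3) * (I.n + I.m))))}
    (hM : Maximal (IsDistMatching (I.graph p) (2 * (p + 1))) M)
    (hlight : ∀ e ∈ M, (∃ i, e = I.chosenEdge p i) ∨ ∃ i, e = I.spareEdge p i) (x : Fin I.n) :
    ∃ i, I.chosenEdge p i ∈ M ∧ x ∈ I.S i := by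
  by_contra! hx
  have hdist : ∀ e ∈ M, ((2 * (p + 1) : ℕ) : ℕ∞) ≤ edgeDist (I.graph p) e (I.probeEdge p x) := by
    intro e he
    rcases hlight e he with ⟨i, rfl⟩ | ⟨i, rfl⟩
    · exact le_edgeDist_chosenEdge_probeEdge (hx i he)
    · exact le_edgeDist_spareEdge_probeEdge x i
  have hins : IsDistMatching (I.graph p) (2 * (p + 1)) (insert (I.probeEdge p x) M) := by
    refine ⟨?_, ?_⟩
    · simp only [Finset.forall_mem_insert]
      exact ⟨probeEdge_mem x, hM.1.1⟩
    · intro e he f hf hef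
      rw [Finset.mem_insert] at he hf
      rcases he with rfl | he <;> rcases hf with rfl | hf
      · exact absurd rfl hef
      · rw [edgeDist_comm]
        exact hdist f hf
      · exact hdist e he
      · exact hM.1.2 e he f hf hef
  have hmem := hM.2 hins (Finset.subset_insert _ _) (Finset.mem_insert_self _ _)
  rcases hlight _ hmem with ⟨i, h⟩ | ⟨i, h⟩
  · exact probeEdge_ne_chosenEdge x i h
  · exact probeEdge_ne_spareEdge x i h

variable (p) in
/-- The matching of a family of sets: the chosen edges of its members and the spare edges of the
other sets. -/
def matchingOf (D : Finset (Fin I.m)) : Finset (Sym2 (Fin ((p + 3) * (I.n + I.m)))) :=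
  Finset.univ.image fun i => if i ∈ D then I.chosenEdge p i else I.spareEdge p i

lemma isDistMatching_matchingOf (D : Finset (Fin I.m)) :
    IsDistMatching (I.graph p) (2 * (p + 1)) (matchingOf p D) := by
  simp only [IsDistMatching, matchingOf, Finset.forall_mem_image, Finset.mem_univ,
    forall_true_left]
  refine ⟨fun i => ?_, fun i j hij => ?_⟩
  · split_ifs
    · exact chosenEdge_mem i
    · exact spareEdge_mem i
  · have hne : j ≠ i := by
      rintro rfl
      exact hij rfl
    rw [le_edgeDist_iff]
    split_ifs <;>
      simp only [chosenEdge, spareEdge, Sym2.mem_iff, forall_eq_or_imp, forall_eq] <;>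
      refine ⟨⟨?_, ?_⟩, ?_, ?_⟩ <;> apply le_edist_of_le_potential <;>
      simp only [potential, hne, if_false] <;> omega

/-- Each edge has an end within distance `2 * p + 1` of the matching of a cover. -/
lemma exists_edgeDist_lt {D : Finset (Fin I.m)} (hD : ∀ x, ∃ i ∈ D, x ∈ I.S i)
    {g : Sym2 (Fin ((p + 3) * (I.n + I.m)))} (hg : g ∈ (I.graph p).edgeSet) :
    ∃ e ∈ matchingOf p D, edgeDist (I.graph p) g e < ((2 * (p + 1) : ℕ) : ℕ∞) := by
  -- It suffices to treat the lower end of each edge, or the first one at level zero.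
  have key : ∀ a b, I.Arc p a b → ∃ e ∈ matchingOf p D, ∃ v ∈ e,
      (I.graph p).edist (I.node p a) v ≤ ((2 * p + 1 : ℕ) : ℕ∞) := by
    rintro ⟨r, u⟩ ⟨r', v⟩ h
    have hr' := r'.2
    rcases u with x | i
    · have hr : r.val ≤ p := by
        rcases h with ⟨h, -, -⟩ | ⟨h₁, h₂, h₃⟩
        · simp only at h
          omega
        · simp only at h₁ h₃ hr'
          have := h₃ rfl
          omega
      obtain ⟨i, hi, hx⟩ := hD x
      refine ⟨I.chosenEdge p i, Finset.mem_image.2 ⟨i, Finset.mem_univ i, if_pos hi⟩, _,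
        Sym2.mem_mk_left _ _, edist_elem_set_le hx hr⟩
    · have hr : r.val ≤ p + 1 := by
        rcases h with ⟨h, -, -⟩ | ⟨h₁, -, -⟩
        · simp only at h
          omega
        · simp only at h₁ hr'
          omega
      refine ⟨_, Finset.mem_image_of_mem _ (Finset.mem_univ i),
        I.node p (⟨p + 1, by omega⟩, .inr i), ?_,
        (edist_path_le (.inr i) hr (by omega) (by simp)).trans ?_⟩
      · split_ifs <;> simp [chosenEdge, spareEdge]
      · norm_cast
        omega
  induction g using Sym2.ind with
  | _ a b =>
    obtain ⟨a, rfl⟩ := (I.node p).surjective a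
    obtain ⟨b, rfl⟩ := (I.node p).surjective b
    have hlt : ((2 * p + 1 : ℕ) : ℕ∞) < ((2 * (p + 1) : ℕ) : ℕ∞) := by norm_cast; omega
    rcases adj_node.1 hg with h | h
    · obtain ⟨e, he, v, hv, hd⟩ := key _ _ h
      refine ⟨e, he, lt_of_le_of_lt (le_trans ?_ hd) hlt⟩
      exact le_edgeDist_iff.1 le_rfl _ (Sym2.mem_mk_left _ _) v hv
    · obtain ⟨e, he, v, hv, hd⟩ := key _ _ h
      refine ⟨e, he, lt_of_le_of_lt (le_trans ?_ hd) hlt⟩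
      exact le_edgeDist_iff.1 le_rfl _ (Sym2.mem_mk_right _ _) v hv

lemma maximal_matchingOf {D : Finset (Fin I.m)} (hD : ∀ x, ∃ i ∈ D, x ∈ I.S i) :
    Maximal (IsDistMatching (I.graph p) (2 * (p + 1))) (matchingOf p D) := by
  refine ⟨isDistMatching_matchingOf D, fun M hM hle g hg => ?_⟩
  by_contra hgD
  obtain ⟨e, he, hd⟩ := exists_edgeDist_lt hD (hM.1 g hg)
  refine absurd (hM.2 g hg e (hle he) ?_) (not_le.2 hd)
  rintro rfl
  exact hgD he

/-! ### Weights -/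

variable (I p)

/-- The edge weights: chosen edges weigh `1`, spare edges almost nothing, and all other edges are
prohibitively heavy. An edge between two set vertices is determined by the set and the sum of the
two levels. -/
def weight (k : ℕ) : Sym2 (Fin ((p + 3) * (I.n + I.m))) → ℚ :=
  Sym2.lift ⟨fun a b =>
    if ((I.node p).symm a).2.isRight ∧ ((I.node p).symm b).2.isRight then
      if ((I.node p).symm a).1.val + ((I.node p).symm b).1.val = 2 * p + 1 then 1
      else if ((I.node p).symm a).1.val + ((I.node p).symm b).1.val = 2 * p + 3 then 1 / 2 ^ k
      else 2 ^ k
    else 2 ^ k, fun a b => by simp only [and_comm, add_comm]⟩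

/-- The weighted graph of a set cover instance. -/
def weightedGraph (k : ℕ) : WeightedGraph where
  n := (p + 3) * (I.n + I.m)
  G := I.graph p
  w := I.weight p k
  w_pos e _ := by
    induction e using Sym2.ind with
    | _ a b =>
      simp only [weight, Sym2.lift_mk]
      split_ifs <;> positivity

variable {I p}

lemma weight_node (k : ℕ) (a b : Fin (p + 3) × (Fin I.n ⊕ Fin I.m)) :
    I.weight p k s(I.node p a, I.node p b) =
      if a.2.isRight ∧ b.2.isRight then
        if a.1.val + b.1.val = 2 * p + 1 then 1
        else if a.1.val + b.1.val = 2 * p + 3 then 1 / 2 ^ k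
        else 2 ^ k
      else 2 ^ k := by
  simp only [weight, Sym2.lift_mk, Equiv.symm_apply_apply]

lemma weight_nonneg (k : ℕ) (e : Sym2 (Fin ((p + 3) * (I.n + I.m)))) : 0 ≤ I.weight p k e := by
  induction e using Sym2.ind with
  | _ a b =>
    simp only [weight, Sym2.lift_mk]
    split_ifs <;> positivity

lemma weight_chosenEdge (k : ℕ) (i : Fin I.m) : I.weight p k (I.chosenEdge p i) = 1 := by
  rw [chosenEdge, weight_node, if_pos (by simp), if_pos (by simp only; omega)]

lemma weight_spareEdge (k : ℕ) (i : Fin I.m) : I.weight p k (I.spareEdge p i) = 1 / 2 ^ k := by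
  rw [spareEdge, weight_node, if_pos (by simp), if_neg (by simp only; omega),
    if_pos (by simp only; omega)]

lemma light_or_weight_eq (k : ℕ) {e : Sym2 (Fin ((p + 3) * (I.n + I.m)))}
    (he : e ∈ (I.graph p).edgeSet) :
    ((∃ i, e = I.chosenEdge p i) ∨ ∃ i, e = I.spareEdge p i) ∨ I.weight p k e = 2 ^ k := by
  have key : ∀ a b, I.Arc p a b →
      ((∃ i, s(I.node p a, I.node p b) = I.chosenEdge p i) ∨
        ∃ i, s(I.node p a, I.node p b) = I.spareEdge p i) ∨
      I.weight p k s(I.node p a, I.node p b) = 2 ^ k := by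
    rintro ⟨⟨r, hr⟩, u⟩ ⟨⟨r', hr'⟩, v⟩ h
    rw [weight_node]
    rcases u with x | i
    · simp
    rcases h with ⟨-, -, h⟩ | ⟨h, rfl, -⟩
    · exact h.elim
    simp only at h
    subst h
    simp only [Sum.isRight_inr, and_self, if_true]
    split_ifs with h₁ h₂
    · obtain rfl : r = p := by omega
      exact Or.inl (Or.inl ⟨i, rfl⟩)
    · obtain rfl : r = p + 1 := by omega
      exact Or.inl (Or.inr ⟨i, rfl⟩)
    · exact Or.inr rfl
  induction e using Sym2.ind with
  | _ a b =>
    obtain ⟨a, rfl⟩ := (I.node p).surjective a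
    obtain ⟨b, rfl⟩ := (I.node p).surjective b
    rcases adj_node.1 he with h | h
    · exact key a b h
    · rw [Sym2.eq_swap]
      exact key b a h

lemma cost_matchingOf_le (k : ℕ) (D : Finset (Fin I.m)) :
    ∑ e ∈ matchingOf p D, I.weight p k e ≤ D.card + I.m * (1 / 2 ^ k) := by
  calc ∑ e ∈ matchingOf p D, I.weight p k e
      ≤ ∑ i, I.weight p k (if i ∈ D then I.chosenEdge p i else I.spareEdge p i) :=
        Finset.sum_image_le_of_nonneg fun _ _ => weight_nonneg k _
    _ ≤ ∑ i : Fin I.m, ((if i ∈ D then 1 else 0) + 1 / 2 ^ k) := by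
        refine Finset.sum_le_sum fun i _ => ?_
        split_ifs
        · rw [weight_chosenEdge]
          simp
        · rw [weight_spareEdge]
          simp
    _ = D.card + I.m * (1 / 2 ^ k) := by
        rw [Finset.sum_add_distrib]
        simp

lemma card_le_cost (k : ℕ) (M : Finset (Sym2 (Fin ((p + 3) * (I.n + I.m))))) :
    ((Finset.univ.filter fun i => I.chosenEdge p i ∈ M).card : ℚ) ≤ ∑ e ∈ M, I.weight p k e := by
  calc ((Finset.univ.filter fun i => I.chosenEdge p i ∈ M).card : ℚ)
      = ∑ i ∈ Finset.univ.filter fun i => I.chosenEdge p i ∈ M,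
          I.weight p k (I.chosenEdge p i) := by simp [weight_chosenEdge]
    _ = ∑ e ∈ (Finset.univ.filter fun i => I.chosenEdge p i ∈ M).image (I.chosenEdge p),
          I.weight p k e := (Finset.sum_image fun _ _ _ _ h => chosenEdge_injective h).symm
    _ ≤ ∑ e ∈ M, I.weight p k e := by
        refine Finset.sum_le_sum_of_subset_of_nonneg ?_ fun _ _ _ => weight_nonneg k _
        simp [Finset.subset_iff]

end SetCoverInstance

/-! ### The approximation ratio -/

namespace SetCoverInstance

variable {I : SetCoverInstance} {p : ℕ}

/-- The sets whose chosen edges belong to `M`. -/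
def coverOf (I : SetCoverInstance) (p : ℕ) (M : Finset (Sym2 (Fin ((p + 3) * (I.n + I.m))))) :
    Finset (Fin I.m) :=
  Finset.univ.filter fun i => I.chosenEdge p i ∈ M

lemma mem_coverOf {M : Finset (Sym2 (Fin ((p + 3) * (I.n + I.m))))} {i : Fin I.m} :
    i ∈ I.coverOf p M ↔ I.chosenEdge p i ∈ M := by
  simp [coverOf]

lemma two_mul_card_le {d : ℕ} (hd : 1 ≤ d) (hm : I.m ≤ I.n ^ d) (hn : 4 * (p + 3) ≤ I.n) :
    2 * ((p + 3) * (I.n + I.m)) ≤ I.n ^ (d + 1) := by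
  have h₁ : I.n ≤ I.n ^ d := Nat.le_self_pow (by omega) _
  calc 2 * ((p + 3) * (I.n + I.m)) ≤ 2 * ((p + 3) * (I.n ^ d + I.n ^ d)) := by gcongr
    _ = I.n ^ d * (4 * (p + 3)) := by ring
    _ ≤ I.n ^ d * I.n := by gcongr
    _ = I.n ^ (d + 1) := (pow_succ _ _).symm

lemma sq_card_lt_two_pow {C k : ℕ} (hk : C + 2 * ((p + 3) * (I.n + I.m)) ≤ k) :
    C * ((p + 3) * (I.n + I.m)) * ((p + 3) * (I.n + I.m)) < 2 ^ k := by
  generalize (p + 3) * (I.n + I.m) = V at *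
  calc C * V * V ≤ C * (2 ^ V * 2 ^ V) := by
        rw [mul_assoc]
        exact Nat.mul_le_mul_left _ (Nat.mul_le_mul Nat.lt_two_pow_self.le Nat.lt_two_pow_self.le)
    _ < 2 ^ C * (2 ^ V * 2 ^ V) :=
        Nat.mul_lt_mul_of_pos_right Nat.lt_two_pow_self (by positivity)
    _ = 2 ^ (C + 2 * V) := by ring
    _ ≤ 2 ^ k := Nat.pow_le_pow_right (by omega) hk

/-- A matching within the ratio `c * log |V|` of the optimum is decoded to a cover within the ratio
`c * (d + 1) * log n`. The spare edges cost less than the gap that `2 * |V| ≤ n ^ (d + 1)` leaves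
between the two ratios, and less than `1` if the ratio is `1`. -/
theorem coverOf_approx {d k C : ℕ} {c : ℝ} (hc : 0 < c) (hC : c ≤ C) (hC₂ : 2 ≤ C) (hd : 1 ≤ d)
    (hm : I.m ≤ I.n ^ d) (hn : 4 * (p + 3) ≤ I.n) (hk : C + 2 * ((p + 3) * (I.n + I.m)) ≤ k)
    {M : Finset (Sym2 (Fin ((p + 3) * (I.n + I.m))))}
    (hM : Maximal (IsDistMatching (I.graph p) (2 * (p + 1))) M)
    (happrox : ∀ M', Maximal (IsDistMatching (I.graph p) (2 * (p + 1))) M' →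
      ((∑ e ∈ M, I.weight p k e : ℚ) : ℝ) ≤
        max 1 (c * Real.log ((p + 3) * (I.n + I.m) : ℕ)) *
          ((∑ e ∈ M', I.weight p k e : ℚ) : ℝ)) :
    (∀ x, ∃ i ∈ I.coverOf p M, x ∈ I.S i) ∧
      ∀ D : Finset (Fin I.m), (∀ x, ∃ i ∈ D, x ∈ I.S i) →
        ((I.coverOf p M).card : ℝ) ≤ max 1 (c * (d + 1) * Real.log I.n) * D.card := by
  have hV := two_mul_card_le hd hm hn
  have hVk := sq_card_lt_two_pow (I := I) (p := p) hk
  have hmV : I.m + 1 ≤ (p + 3) * (I.n + I.m) := by nlinarith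
  obtain ⟨V, hVdef⟩ : ∃ V, V = (p + 3) * (I.n + I.m) := ⟨_, rfl⟩
  rw [← hVdef] at hV hVk hmV
  have hV₁ : (1 : ℝ) ≤ V := by exact_mod_cast (by omega : 1 ≤ V)
  have hC₂' : (2 : ℝ) ≤ C := by exact_mod_cast hC₂
  have hmV' : (I.m : ℝ) + 1 ≤ V := by exact_mod_cast hmV
  have hVk' : (C : ℝ) * V * V < 2 ^ k := by exact_mod_cast hVk
  have hlog₀ : 0 ≤ Real.log V := Real.log_nonneg hV₁
  have hlogV : Real.log V ≤ V := (Real.log_le_sub_one_of_pos (by linarith)).trans (by linarith)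
  have hm₀ : (0 : ℝ) ≤ I.m := Nat.cast_nonneg _
  have hsmall : (I.m : ℝ) * (1 / 2 ^ k) < 1 := by
    rw [mul_one_div, div_lt_one (by positivity)]
    nlinarith [mul_le_mul hC₂' hV₁ zero_le_one (by linarith)]
  have hratio : max 1 (c * Real.log V) ≤ C * V := by
    refine max_le (by nlinarith) (mul_le_mul hC hlogV hlog₀ (by linarith))
  -- The cost of the matching of a cover, over the reals.
  have hcost : ∀ D : Finset (Fin I.m), (∀ x, ∃ i ∈ D, x ∈ I.S i) →
      ((∑ e ∈ M, I.weight p k e : ℚ) : ℝ) ≤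
        max 1 (c * Real.log V) * (D.card + I.m * (1 / 2 ^ k)) := by
    intro D hD
    have h := happrox _ (maximal_matchingOf hD)
    rw [show Real.log ((p + 3) * (I.n + I.m) : ℕ) = Real.log V by rw [hVdef]] at h
    refine h.trans
      (mul_le_mul_of_nonneg_left ?_ (by positivity))
    have := cost_matchingOf_le (I := I) (p := p) k D
    have h' : ((∑ e ∈ matchingOf p D, I.weight p k e : ℚ) : ℝ) ≤
        ((D.card + I.m * (1 / 2 ^ k) : ℚ) : ℝ) := Rat.cast_le.2 this
    push_cast at h' ⊢
    exact h'
  have hlight : ∀ e ∈ M, (∃ i, e = I.chosenEdge p i) ∨ ∃ i, e = I.spareEdge p i := by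
    intro e he
    refine (light_or_weight_eq k (hM.1.1 e he)).resolve_right fun hheavy => ?_
    have h₁ : (2 : ℝ) ^ k ≤ ((∑ e ∈ M, I.weight p k e : ℚ) : ℝ) := by
      have := Finset.single_le_sum (fun e _ => weight_nonneg (I := I) (p := p) k e) he
      rw [hheavy] at this
      exact_mod_cast this
    have h₂ := hcost Finset.univ fun x => by simpa using I.covers x
    rw [Finset.card_univ, Fintype.card_fin] at h₂
    have h₃ : max 1 (c * Real.log V) * (I.m + I.m * (1 / 2 ^ k)) ≤ C * V * V :=
      mul_le_mul hratio (by linarith) (by positivity) (by positivity)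
    linarith
  refine ⟨fun x => ?_, fun D hD => ?_⟩
  · obtain ⟨i, hi, hx⟩ := cover_of_maximal hM hlight x
    exact ⟨i, mem_coverOf.2 hi, hx⟩
  have hle : ((I.coverOf p M).card : ℝ) ≤
      max 1 (c * Real.log V) * (D.card + I.m * (1 / 2 ^ k)) := by
    refine le_trans ?_ (hcost D hD)
    exact_mod_cast card_le_cost (I := I) (p := p) k M
  have hD₁ : (1 : ℝ) ≤ D.card := by
    obtain ⟨i, hi, -⟩ := hD ⟨0, by omega⟩
    exact_mod_cast Finset.card_pos.2 ⟨i, hi⟩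
  rcases le_total (c * Real.log V) 1 with hone | hone
  · rw [max_eq_left hone, one_mul] at hle
    have hlt : ((I.coverOf p M).card : ℝ) < D.card + 1 := by linarith
    have hle' : (I.coverOf p M).card ≤ D.card := Nat.lt_succ_iff.1 (by exact_mod_cast hlt)
    have hle'' : ((I.coverOf p M).card : ℝ) ≤ D.card := by exact_mod_cast hle'
    nlinarith [le_max_left 1 (c * (d + 1) * Real.log I.n)]
  · rw [max_eq_right hone] at hle
    have hgap : Real.log V + Real.log 2 ≤ (d + 1) * Real.log I.n := by
      rw [← Real.log_mul (by positivity) (by norm_num), show ((d : ℝ) + 1) = ((d + 1 : ℕ) : ℝ) by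
        push_cast; ring, ← Real.log_pow]
      refine Real.log_le_log (by positivity) ?_
      rw [mul_comm]
      exact_mod_cast hV
    have hspare : Real.log V * (I.m * (1 / 2 ^ k)) ≤ 1 / 2 := by
      have h₁ : 2 * (V * (V : ℝ)) ≤ 2 ^ k := by
        nlinarith [mul_le_mul_of_nonneg_right hC₂' (by positivity : (0 : ℝ) ≤ V * V)]
      rw [mul_one_div, mul_div_assoc', div_le_iff₀ (by positivity)]
      nlinarith
    have hlog2 : 1 / 2 < Real.log 2 := by linarith [Real.log_two_gt_d9]
    refine hle.trans (le_trans ?_ (mul_le_mul_of_nonneg_right (le_max_right _ _) (by positivity)))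
    calc c * Real.log V * (D.card + I.m * (1 / 2 ^ k))
        = c * (Real.log V * D.card + Real.log V * (I.m * (1 / 2 ^ k))) := by ring
      _ ≤ c * (Real.log V * D.card + Real.log 2 * D.card) := by
          refine mul_le_mul_of_nonneg_left ?_ hc.le
          nlinarith
      _ = c * (Real.log V + Real.log 2) * D.card := by ring
      _ ≤ c * ((d + 1) * Real.log I.n) * D.card := by gcongr
      _ = c * (d + 1) * Real.log I.n * D.card := by ring

end SetCoverInstance

/-! ### Sizes of encodings -/

namespace Data

lemma length_le_size (L : List Data) : L.length ≤ (ofList L).size := by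
  induction L with
  | nil => simp
  | cons a L ih =>
    simp only [List.length_cons, ofList_cons, size]
    omega

lemma size_ofList_le {L : List Data} {B : ℕ} (h : ∀ a ∈ L, a.size ≤ B) :
    (ofList L).size ≤ 1 + L.length * (B + 1) := by
  induction L with
  | nil => simp [size]
  | cons a L ih =>
    have h₁ := h a (by simp)
    have h₂ := ih fun b hb => h b (by simp [hb])
    simp only [List.length_cons, ofList_cons, size, Nat.succ_mul]
    omega

lemma ofNat_one : ofNat 1 = cons (cons nil nil) nil := by
  simp [ofNat, ofBool]

lemma ofNat_two_pow (k : ℕ) :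
    ofNat (2 ^ k) = ofList (List.replicate k nil ++ [cons nil nil]) := by
  have h : (2 ^ k).bits = List.replicate k false ++ [true] := by
    induction k with
    | zero => simp
    | succ k ih => rw [pow_succ', Nat.bit0_bits _ (by positivity), ih]; rfl
  rw [ofNat, h]
  simp [ofBool]

lemma ofRat_two_pow (k : ℕ) : ofRat (2 ^ k) = cons (ofNat (2 ^ k)) (ofNat 1) := by
  have h : (2 ^ k : ℚ) = ((2 ^ k : ℕ) : ℚ) := by push_cast; rfl
  rw [ofRat, h, Rat.num_natCast, Rat.den_natCast]
  rfl

lemma ofRat_one_div_two_pow (k : ℕ) :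
    ofRat (1 / 2 ^ k) = cons (ofNat 1) (ofNat (2 ^ k)) := by
  have h : (1 / 2 ^ k : ℚ) = ((2 ^ k : ℕ) : ℚ)⁻¹ := by push_cast; rw [one_div]
  rw [ofRat, h, Rat.inv_natCast_num_of_pos (by positivity),
    Rat.inv_natCast_den_of_pos (by positivity)]
  rfl

lemma size_ofNat_two_pow_le (k : ℕ) : (ofNat (2 ^ k)).size ≤ 1 + (k + 1) * 4 := by
  rw [ofNat_two_pow]
  refine (size_ofList_le (B := 3) ?_).trans (by simp)
  intro a ha
  simp only [List.mem_append, List.mem_replicate, List.mem_singleton] at ha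
  rcases ha with ⟨-, rfl⟩ | rfl <;> simp [size]

end Data

namespace PolyTime

variable {ι : Type} {N : ι → ℕ} {g : ι → Data}

lemma drop_ofUnary {A : ι → List Data} {k : ι → ℕ} (hA : PolyTime N g fun i => Data.ofList (A i))
    (hk : PolyTime N g fun i => Data.ofUnary (k i)) (hb : PolyBounded N k) :
    PolyTime N g fun i => Data.ofList ((A i).drop (k i)) :=
  (hA.drop (B := fun i => List.replicate (k i) Data.nil) hk (by simpa using hb)).congr
    fun i => by simp

lemma getD {A : ι → List Data} {k : ι → ℕ} (hA : PolyTime N g fun i => Data.ofList (A i))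
    (hk : PolyTime N g fun i => Data.ofUnary (k i)) (hb : PolyBounded N k) :
    PolyTime N g fun i => (A i).getD (k i) Data.nil :=
  (hA.drop_ofUnary hk hb).head.congr fun _ => Data.head_ofList_drop _ _

end PolyTime

lemma PolyDec.lt {ι : Type} {N : ι → ℕ} {g : ι → Data} {k k' : ι → ℕ}
    (h : PolyTime N g fun i => Data.ofUnary (k i)) (hb : PolyBounded N k)
    (h' : PolyTime N g fun i => Data.ofUnary (k' i)) : PolyDec N g fun i => k i < k' i :=
  (PolyDec.of_ne_nil (PolyTime.drop_ofUnary (A := fun i => List.replicate (k' i) Data.nil)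
    h' h hb)).congr fun i => by simp; omega

/-! ### Computing the columns of the graph -/

namespace SetCoverInstance

lemma n_le_size (I : SetCoverInstance) : I.n ≤ I.encode.size := by
  have := Data.length_le_size (List.replicate I.n Data.nil)
  rw [List.length_replicate] at this
  simp only [encode, Data.size, Data.ofUnary]
  omega

lemma m_le_size (I : SetCoverInstance) : I.m ≤ I.encode.size := by
  have := Data.length_le_size (List.ofFn fun i : Fin I.m =>
    Data.ofList (List.ofFn fun x : Fin I.n => Data.ofBool (decide (x ∈ I.S i))))
  rw [List.length_ofFn] at this
  simp only [encode, Data.size]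
  omega

lemma polyBounded_n : PolyBounded (fun I : SetCoverInstance => I.encode.size) fun I => I.n :=
  PolyBounded.refl.mono n_le_size

lemma polyBounded_m : PolyBounded (fun I : SetCoverInstance => I.encode.size) fun I => I.m :=
  PolyBounded.refl.mono m_le_size

variable (I : SetCoverInstance)

/-- The incidence row of a set. -/
def incidence (i : Fin I.m) : List Data :=
  List.ofFn fun x : Fin I.n => Data.ofBool (decide (x ∈ I.S i))

/-- The elements and the sets, in the order of the vertices of a level. -/
def columns : List (Fin I.n ⊕ Fin I.m) := List.ofFn fun j => finSumFinEquiv.symm j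

/-- The position of an element among the elements, and of a set among the sets. -/
def position : Fin I.n ⊕ Fin I.m → ℕ
  | .inl x => x
  | .inr i => i

/-- What a program knows of a column: its position, its kind, and the incidence row of a set. -/
def columnData (u : Fin I.n ⊕ Fin I.m) : Data :=
  Data.cons (Data.ofUnary (I.position u))
    (Data.cons (Data.ofBool u.isRight) (Data.ofList (u.elim (fun _ => []) I.incidence)))

lemma length_columns : I.columns.length = I.n + I.m := by simp [columns]

lemma position_le (u : Fin I.n ⊕ Fin I.m) : I.position u ≤ I.n + I.m := by
  rcases u with x | i <;> simp only [position] <;> omega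

lemma map_columns {α : Type*} (f : Fin I.n ⊕ Fin I.m → α) :
    I.columns.map f = (List.ofFn fun x => f (.inl x)) ++ List.ofFn fun i => f (.inr i) := by
  rw [columns, List.map_ofFn, List.ofFn_add]
  congr 2 <;> funext x
  · exact congrArg f (finSumFinEquiv_symm_apply_castAdd x)
  · exact congrArg f (finSumFinEquiv_symm_apply_natAdd x)

lemma polyTime_n : PolyTime (fun I : SetCoverInstance => I.encode.size) encode
    fun I => Data.ofUnary I.n := PolyTime.refl.head.congr fun _ => rfl

lemma polyTime_sets : PolyTime (fun I : SetCoverInstance => I.encode.size) encode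
    fun I => Data.ofList (List.ofFn fun i => Data.ofList (I.incidence i)) :=
  PolyTime.refl.tail.congr fun _ => rfl

lemma polyTime_m : PolyTime (fun I : SetCoverInstance => I.encode.size) encode
    fun I => Data.ofUnary I.m :=
  (PolyTime.map (L := fun I : SetCoverInstance => List.finRange I.m)
    (enc := fun I i => Data.ofList (I.incidence i)) (out := fun _ _ => Data.nil) PolyTime.nil
    (polyTime_sets.congr fun I => by rw [List.ofFn_eq_map]) (by simpa using polyBounded_m)
    PolyTime.nil).congr fun I => by simp [Data.ofUnary]

lemma polyTime_columns : PolyTime (fun I : SetCoverInstance => I.encode.size) encode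
    fun I => Data.ofList (I.columns.map I.columnData) := by
  have elems := PolyTime.map (L := fun I : SetCoverInstance => List.finRange I.n)
    (enc := fun I x => Data.ofUnary x) (out := fun I x => I.columnData (.inl x)) PolyTime.nil
    ((PolyTime.ofUnary_range polyTime_n polyBounded_n).congr fun I => by rw [List.ofFn_eq_map])
    (by simpa using polyBounded_n)
    (PolyTime.refl.snd.cons (PolyTime.const (Data.cons Data.nil Data.nil)))
  have sets := PolyTime.map (L := fun I : SetCoverInstance => List.finRange I.m)
    (enc := fun I i => Data.ofUnary i) (out := fun I i => I.columnData (.inr i)) polyTime_sets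
    ((PolyTime.ofUnary_range polyTime_m polyBounded_m).congr fun I => by rw [List.ofFn_eq_map])
    (by simpa using polyBounded_m)
    ((PolyTime.refl.snd.cons ((PolyTime.const (Data.ofBool true)).cons
      (PolyTime.getD PolyTime.refl.fst PolyTime.refl.snd
        ((polyBounded_m.comap Sigma.fst).mono fun x => x.2.2.le)))).congr fun x => by
          simp [columnData, position])
  exact (elems.append sets (by simpa using polyBounded_n)).congr fun I => by
    rw [map_columns, List.ofFn_eq_map, List.ofFn_eq_map]

/-! ### Computing the weighted adjacency matrix -/

section Adjacency

variable {ι : Type} {N : ι → ℕ} {g : ι → Data} {I : ι → SetCoverInstance}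
  {u v : (i : ι) → Fin (I i).n ⊕ Fin (I i).m}

lemma polyDec_isRight (hu : PolyTime N g fun i => (I i).columnData (u i)) :
    PolyDec N g fun i => (u i).isRight = true :=
  (PolyDec.of_ne_nil hu.snd.fst).congr fun _ => Data.ofBool_ne_nil

lemma polyDec_link (hN : PolyBounded N fun i => (I i).n + (I i).m)
    (hu : PolyTime N g fun i => (I i).columnData (u i))
    (hv : PolyTime N g fun i => (I i).columnData (v i)) :
    PolyDec N g fun i => (I i).Link (u i) (v i) := by
  have hb : PolyBounded N fun i => (I i).position (u i) := hN.mono fun i => position_le _ _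
  refine ((polyDec_isRight hu).not.and ((polyDec_isRight hv).ite
    (PolyDec.of_ne_nil (PolyTime.getD hv.snd.snd hu.fst hb))
    (PolyDec.lt hu.fst hb hv.fst))).congr fun i => ?_
  rcases u i with x | j <;> rcases v i with y | k <;>
    simp [Link, position, incidence, Data.ofBool_ne_nil]

lemma polyDec_eq (hN : PolyBounded N fun i => (I i).n + (I i).m)
    (hu : PolyTime N g fun i => (I i).columnData (u i))
    (hv : PolyTime N g fun i => (I i).columnData (v i)) :
    PolyDec N g fun i => u i = v i := by
  have hbu : PolyBounded N fun i => (I i).position (u i) := hN.mono fun i => position_le _ _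
  have hbv : PolyBounded N fun i => (I i).position (v i) := hN.mono fun i => position_le _ _
  refine (((polyDec_isRight hu).ite (polyDec_isRight hv) (polyDec_isRight hv).not).and
    ((PolyDec.lt hu.fst hbu hv.fst).not.and (PolyDec.lt hv.fst hbv hu.fst).not)).congr fun i => ?_
  rcases u i with x | j <;> rcases v i with y | k <;>
    simp only [position, Sum.isRight_inl, Sum.isRight_inr, Sum.inl.injEq, Sum.inr.injEq,
      Fin.ext_iff, reduceCtorEq] <;> simp <;> omega

lemma polyDec_arc {p : ℕ} (r r' : Fin (p + 3)) (hN : PolyBounded N fun i => (I i).n + (I i).m)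
    (hu : PolyTime N g fun i => (I i).columnData (u i))
    (hv : PolyTime N g fun i => (I i).columnData (v i)) :
    PolyDec N g fun i => (I i).Arc p (r, u i) (r', v i) :=
  ((((PolyDec.const (r.val = 0)).and
    ((PolyDec.const (r'.val = 0)).and (polyDec_link hN hu hv)))).or
    ((PolyDec.const (r'.val = r.val + 1)).and ((polyDec_eq hN hu hv).and
      ((polyDec_isRight hu).or (PolyDec.const (r'.val ≤ p + 1)))))).congr fun i => by
        simp only [Arc]
        rcases u i <;> simp

end Adjacency

variable (p k : ℕ)

open Classical in
/-- An entry of the weighted adjacency matrix. -/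
noncomputable def matrixEntry (r r' : Fin (p + 3)) (u v : Fin I.n ⊕ Fin I.m) : Data :=
  if (I.graph p).Adj (I.node p (r, u)) (I.node p (r', v)) then
    Data.ofRat (I.weight p k s(I.node p (r, u), I.node p (r', v))) else Data.nil

lemma polyTime_matrixEntry {ι : Type} {N : ι → ℕ} {g : ι → Data} {I : ι → SetCoverInstance}
    {u v : (i : ι) → Fin (I i).n ⊕ Fin (I i).m} {k : ι → ℕ} (r r' : Fin (p + 3))
    (hN : PolyBounded N fun i => (I i).n + (I i).m)
    (hk : PolyTime N g fun i => Data.ofNat (2 ^ k i))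
    (hu : PolyTime N g fun i => (I i).columnData (u i))
    (hv : PolyTime N g fun i => (I i).columnData (v i)) :
    PolyTime N g fun i => (I i).matrixEntry p (k i) r r' (u i) (v i) := by
  have heavy : PolyTime N g fun i => Data.ofRat (2 ^ k i) :=
    (hk.cons (PolyTime.const (Data.ofNat 1))).congr fun _ => (Data.ofRat_two_pow _).symm
  have spare : PolyTime N g fun i => Data.ofRat (1 / 2 ^ k i) :=
    ((PolyTime.const (Data.ofNat 1)).cons hk).congr fun _ => (Data.ofRat_one_div_two_pow _).symm
  have wt : PolyTime N g fun i =>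
      Data.ofRat ((I i).weight p (k i) s((I i).node p (r, u i), (I i).node p (r', v i))) := by
    simp only [weight_node]
    refine PolyTime.ite (f := fun i => Data.ofRat
      (if r.val + r'.val = 2 * p + 1 then 1
        else if r.val + r'.val = 2 * p + 3 then 1 / 2 ^ k i else 2 ^ k i))
      ((polyDec_isRight hu).and (polyDec_isRight hv)) ?_ heavy
      (fun i hi => by rw [if_pos hi]) fun i hi => by rw [if_neg hi]
    split_ifs
    · exact PolyTime.const _
    · exact spare
    · exact heavy
  exact PolyTime.ite ((polyDec_arc r r' hN hu hv).or (polyDec_arc r' r hN hv hu)) wt PolyTime.nil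
    (fun i hi => by rw [matrixEntry, if_pos (adj_node.2 hi)])
    fun i hi => by rw [matrixEntry, if_neg (adj_node.not.2 hi)]

lemma ofFn_node {α : Type*} (f : Fin ((p + 3) * (I.n + I.m)) → α) :
    List.ofFn f =
      (List.ofFn fun r => I.columns.map fun u => f (I.node p (r, u))).flatten := by
  rw [List.ofFn_mul]
  congr 1
  congr 1
  funext r
  rw [columns, List.map_ofFn]
  congr 1
  funext j
  simp only [Function.comp_apply, node, Equiv.trans_apply, Equiv.prodCongr_apply, Prod.map_apply,
    Equiv.refl_apply, Equiv.apply_symm_apply]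
  congr 1
  rw [Fin.ext_iff, finProdFinEquiv_apply_val]
  simp only
  ring

lemma encode_weightedGraph : (I.weightedGraph p k).encode =
    Data.ofList (List.ofFn fun r => I.columns.map fun u =>
      Data.ofList (List.ofFn fun r' => I.columns.map fun v =>
        I.matrixEntry p k r r' u v).flatten).flatten := by
  classical
  rw [WeightedGraph.encode]
  change Data.ofList (List.ofFn (n := (p + 3) * (I.n + I.m)) fun a =>
    Data.ofList (List.ofFn (n := (p + 3) * (I.n + I.m)) fun b =>
      if (I.graph p).Adj a b then Data.ofRat (I.weight p k s(a, b)) else Data.nil)) = _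
  simp only [ofFn_node]
  rfl

lemma polyTime_ofNat_two_pow (K : ℕ) :
    PolyTime (fun I : SetCoverInstance => I.encode.size) encode
      fun I => Data.ofNat (2 ^ (K * (I.n + I.m))) := by
  have hb : PolyBounded (fun I : SetCoverInstance => I.encode.size)
      fun I => I.columns.length := by
    simpa only [length_columns] using polyBounded_n.add polyBounded_m
  have zeros := PolyTime.flatten_ofFn (q := K)
    (fun _ => PolyTime.map (out := fun _ _ => Data.nil) PolyTime.nil polyTime_columns hb
      PolyTime.nil) fun _ => by simpa using hb
  refine (zeros.append (PolyTime.const (Data.ofList [Data.cons Data.nil Data.nil]))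
    (((PolyBounded.const K).mul hb).mono fun I => by simp)).congr fun I => ?_
  rw [Data.ofNat_two_pow]
  congr 2
  rw [List.eq_replicate_iff]
  simp [length_columns]

theorem polyTime_weightedGraph (K : ℕ) :
    PolyTime (fun I : SetCoverInstance => I.encode.size) encode
      fun I => (I.weightedGraph p (K * (I.n + I.m))).encode := by
  have hN := polyBounded_n.add polyBounded_m
  have hb : PolyBounded (fun I : SetCoverInstance => I.encode.size)
      fun I => I.columns.length := by
    simpa only [length_columns] using hN
  have entry (r r' : Fin (p + 3)) := polyTime_matrixEntry p r r'
    (ι := Σ x : (Σ I : SetCoverInstance, Fin I.n ⊕ Fin I.m), Fin x.1.n ⊕ Fin x.1.m)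
    (g := fun y => Data.cons (Data.cons (Data.cons
      (Data.ofList (y.1.1.columns.map y.1.1.columnData))
      (Data.ofNat (2 ^ (K * (y.1.1.n + y.1.1.m))))) (y.1.1.columnData y.1.2))
      (y.1.1.columnData y.2))
    (I := fun y => y.1.1) (u := fun y => y.1.2) (v := fun y => y.2)
    (k := fun y => K * (y.1.1.n + y.1.1.m))
    ((hN.comap Sigma.fst).comap Sigma.fst) PolyTime.refl.fst.fst.snd PolyTime.refl.fst.snd
    PolyTime.refl.snd
  have row (r : Fin (p + 3)) := PolyTime.flatten_ofFn
    (F := fun r' (x : Σ I : SetCoverInstance, Fin I.n ⊕ Fin I.m) =>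
      x.1.columns.map fun v => x.1.matrixEntry p (K * (x.1.n + x.1.m)) r r' x.2 v)
    (fun r' => PolyTime.map (enc := fun x v => x.1.columnData v)
      (env := fun x => Data.cons (Data.cons (Data.ofList (x.1.columns.map x.1.columnData))
        (Data.ofNat (2 ^ (K * (x.1.n + x.1.m))))) (x.1.columnData x.2))
      PolyTime.refl PolyTime.refl.fst.fst (hb.comap Sigma.fst) (entry r r'))
    fun r' => by simpa only [List.length_map] using hb.comap Sigma.fst
  exact (PolyTime.flatten_ofFn (F := fun r (I : SetCoverInstance) => I.columns.map fun u =>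
      Data.ofList (List.ofFn fun r' => I.columns.map fun v =>
        I.matrixEntry p (K * (I.n + I.m)) r r' u v).flatten)
    (fun r => PolyTime.map (polyTime_columns.cons (polyTime_ofNat_two_pow K)) polyTime_columns hb
      (row r))
    fun r => by simpa only [List.length_map] using hb).congr
      fun I => (I.encode_weightedGraph p _).symm

lemma size_matrixEntry_le (r r' : Fin (p + 3)) (u v : Fin I.n ⊕ Fin I.m) :
    (I.matrixEntry p k r r' u v).size ≤ 4 * k + 20 := by
  have h₁ := Data.size_ofNat_two_pow_le k
  have h₂ : (Data.ofNat 1).size = 5 := by simp [Data.ofNat_one, Data.size]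
  rw [matrixEntry, weight_node]
  split_ifs
  · simp only [Data.ofRat, Data.size, Rat.num_one, Rat.den_one, Int.toNat_one, h₂]
    omega
  · simp only [Data.ofRat_one_div_two_pow, Data.size, h₂]
    omega
  · simp only [Data.ofRat_two_pow, Data.size, h₂]
    omega
  · simp only [Data.ofRat_two_pow, Data.size, h₂]
    omega
  · simp only [Data.size]
    omega

lemma size_encode_weightedGraph_le : (I.weightedGraph p k).encode.size ≤
    1 + (p + 3) * (I.n + I.m) * (1 + (p + 3) * (I.n + I.m) * (4 * k + 20 + 1) + 1) := by
  have hlen : ∀ F : Fin (p + 3) → Fin I.n ⊕ Fin I.m → Data,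
      (List.ofFn fun r => I.columns.map (F r)).flatten.length = (p + 3) * (I.n + I.m) := by
    intro F
    rw [List.length_flatten, List.map_ofFn]
    simp only [Function.comp_def, List.length_map, length_columns, List.ofFn_const,
      List.sum_replicate, smul_eq_mul]
  rw [encode_weightedGraph]
  refine (Data.size_ofList_le ?_).trans (by rw [hlen])
  simp only [List.mem_flatten, List.mem_ofFn, exists_exists_eq_and, List.mem_map]
  rintro _ ⟨r, u, -, rfl⟩
  refine (Data.size_ofList_le ?_).trans (by rw [hlen])
  simp only [List.mem_flatten, List.mem_ofFn, exists_exists_eq_and, List.mem_map]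
  rintro _ ⟨r', v, -, rfl⟩
  exact I.size_matrixEntry_le p k r r' u v

lemma polyBounded_size_weightedGraph (K : ℕ) :
    PolyBounded (fun I : SetCoverInstance => I.encode.size)
      fun I => (I.weightedGraph p (K * (I.n + I.m))).encode.size := by
  have hN := polyBounded_n.add polyBounded_m
  have hV := (PolyBounded.const (p + 3)).mul hN
  have hk := (PolyBounded.const (N := fun I : SetCoverInstance => I.encode.size) K).mul hN
  exact ((PolyBounded.const 1).add (hV.mul (((PolyBounded.const 1).add (hV.mul
    ((((PolyBounded.const 4).mul hk).add (PolyBounded.const 20)).add (PolyBounded.const 1)))).add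
    (PolyBounded.const 1)))).mono fun I => I.size_encode_weightedGraph_le p _

/-! ### Reading off the cover -/

variable {I p} in
lemma getD_drop_ofFn_node (r : ℕ) (f : Fin ((p + 3) * (I.n + I.m)) → Data) (hr : r < p + 3)
    (i : Fin I.m) : ((List.ofFn f).drop (r * (I.n + I.m) + I.n)).getD i Data.nil =
      f (I.node p (⟨r, hr⟩, .inr i)) := by
  have hval : (I.node p (⟨r, hr⟩, .inr i)).val = r * (I.n + I.m) + I.n + i := by
    simp [node]
    ring
  have hlt := (I.node p (⟨r, hr⟩, .inr i)).2
  rw [hval] at hlt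
  rw [List.getD_eq_getElem?_getD, List.getElem?_drop, List.getElem?_ofFn, dif_pos hlt,
    Option.getD_some]
  congr 1
  rw [Fin.ext_iff, hval]

/-- The `0`-`1` vector of the cover is a part of the `0`-`1` matrix of the matching. -/
theorem polyTime_coverOf {ι : Type} {I : ι → SetCoverInstance}
    (M : (j : ι) → Finset (Sym2 (Fin ((p + 3) * ((I j).n + (I j).m))))) :
    PolyTime (fun j => (I j).encode.size)
      (fun j => Data.cons (Data.ofList (List.ofFn fun a => Data.ofList (List.ofFn fun b =>
        Data.ofBool (decide (s(a, b) ∈ M j))))) (I j).encode)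
      fun j => Data.ofList (List.ofFn fun i =>
        Data.ofBool (decide (i ∈ (I j).coverOf p (M j)))) := by
  have hn := polyBounded_n.comap I
  have hm := polyBounded_m.comap I
  have hcol : PolyBounded (fun j => (I j).encode.size)
      fun j => ((I j).columns.map (I j).columnData).length := by
    simpa [length_columns] using hn.add hm
  have hi := hm.comap (Sigma.fst : (Σ j, Fin (I j).m) → ι) |>.mono fun x => x.2.2.le
  have hcol' := hcol.comap (Sigma.fst : (Σ j, Fin (I j).m) → ι)
  have hn' := hn.comap (Sigma.fst : (Σ j, Fin (I j).m) → ι)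
  -- The edges of the cover are on a diagonal of the block of rows that starts at the sets of level
  -- `p` and of columns that starts at the sets of level `p + 1`.
  have ctx := PolyTime.refl (N := fun x : Σ j, Fin (I j).m => (I x.1).encode.size)
    (g := fun x => Data.cons (Data.cons (Data.ofList (List.ofFn fun a =>
      Data.ofList (List.ofFn fun b => Data.ofBool (decide (s(a, b) ∈ M x.1)))))
      (Data.cons (Data.ofList ((I x.1).columns.map (I x.1).columnData))
        (Data.ofUnary (I x.1).n))) (Data.ofUnary x.2))
  have row := (((ctx.fst.fst.drop_mul p ctx.fst.snd.fst hcol').drop_ofUnary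
    ctx.fst.snd.snd hn').getD ctx.snd hi).congr
    (f' := fun x => Data.ofList (List.ofFn fun b => Data.ofBool (decide
      (s((I x.1).node p (⟨p, by omega⟩, .inr x.2), b) ∈ M x.1)))) fun x => by
    simp only [List.length_map, length_columns, List.drop_drop]
    exact getD_drop_ofFn_node p _ _ _
  have body := (((row.drop_mul (p + 1) ctx.fst.snd.fst hcol').drop_ofUnary
    ctx.fst.snd.snd hn').getD ctx.snd hi).congr
    (f' := fun x => Data.ofBool (decide (x.2 ∈ (I x.1).coverOf p (M x.1)))) fun x => by
    simp only [List.length_map, length_columns, List.drop_drop]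
    rw [getD_drop_ofFn_node (p + 1) _ (by omega)]
    exact congrArg Data.ofBool (decide_eq_decide.2 mem_coverOf.symm)
  exact (PolyTime.map (L := fun j => List.finRange (I j).m)
    (PolyTime.refl.fst.cons ((PolyTime.refl.snd.comp (polyTime_columns.comap I)).cons
      (PolyTime.refl.snd.comp (polyTime_n.comap I))))
    ((PolyTime.refl.snd.comp ((PolyTime.ofUnary_range polyTime_m polyBounded_m).comap I)).congr
      fun j => by rw [List.ofFn_eq_map]) (by simpa using hm) body).congr
      fun j => by rw [List.ofFn_eq_map]

end SetCoverInstance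

/-! ### Finitely many exceptional instances -/

lemma PolyDec.eq_const {ι : Type} {N : ι → ℕ} {g f : ι → Data} (hf : PolyTime N g f) (d : Data) :
    PolyDec N g fun i => f i = d := by
  induction d generalizing f with
  | nil => exact (PolyDec.of_ne_nil hf).not.congr fun i => by simp
  | cons a b ha hb =>
    refine ((PolyDec.of_ne_nil hf).and ((ha hf.head).and (hb hf.tail))).congr fun i => ?_
    cases f i <;> simp

/-- A program can be patched on finitely many inputs by a table. -/
lemma PolyTime.of_finite_compl {ι : Type} {N : ι → ℕ} {g f : ι → Data}
    (hg : Function.Injective g) {S : Set ι} (hS : S.Finite)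
    (h : PolyTime (ι := {i // i ∉ S}) (fun i => N i) (fun i => g i) fun i => f i) :
    PolyTime N g f := by
  induction S, hS using Set.Finite.induction_on with
  | empty => exact h.comap fun i => ⟨i, id⟩
  | @insert a S _ _ ih =>
    refine ih (PolyTime.cond (PolyDec.eq_const PolyTime.refl (g a))
      ((PolyTime.const (f a)).congr fun i => ?_)
      (h.comap fun i : {i : {i // i ∉ S} // ¬ g i = g a} =>
        ⟨i.1.1, fun hi => hi.elim (fun e => i.2 (congrArg g e)) i.1.2⟩))
    rw [hg i.2]

namespace SetCoverInstance

lemma encode_injective : Function.Injective encode := by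
  rintro ⟨n, m, S, hS⟩ ⟨n', m', S', hS'⟩ h
  simp only [encode, Data.cons.injEq] at h
  obtain rfl := Data.ofUnary_injective h.1
  have h₂ := Data.ofList_injective h.2
  obtain rfl : m = m' := by simpa using congrArg List.length h₂
  obtain rfl : S = S' := by
    funext i
    have h₃ := Data.ofList_injective (congrFun (List.ofFn_injective h₂) i)
    ext x
    exact decide_eq_decide.1 (Data.ofBool_injective (congrFun (List.ofFn_injective h₃) x))
  rfl

/-- The `0`-`1` vector of a family of sets. -/
def vector (I : SetCoverInstance) (D : Finset (Fin I.m)) : Data :=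
  Data.ofList (List.ofFn fun i => Data.ofBool (decide (i ∈ D)))

lemma finite_setOf_n_lt (d n₀ : ℕ) :
    {I : SetCoverInstance | I.n < n₀ ∧ I.m ≤ I.n ^ d}.Finite := by
  let f : {x : Σ n : Fin n₀, Σ m : Fin (n₀ ^ d + 1), Fin m → Finset (Fin n) //
      ∀ e, ∃ i, e ∈ x.2.2 i} → SetCoverInstance := fun x =>
    ⟨x.1.1, x.1.2.1, x.1.2.2, x.2⟩
  refine (Set.finite_range f).subset ?_
  rintro ⟨n, m, S, h⟩ ⟨hn, hm⟩
  exact ⟨⟨⟨⟨n, hn⟩, ⟨m, Nat.lt_succ_of_le (hm.trans (Nat.pow_le_pow_left hn.le d))⟩, S⟩, h⟩, rfl⟩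

lemma exists_optimal (I : SetCoverInstance) : ∃ D : Finset (Fin I.m), (∀ x, ∃ i ∈ D, x ∈ I.S i) ∧
    ∀ D' : Finset (Fin I.m), (∀ x, ∃ i ∈ D', x ∈ I.S i) → D.card ≤ D'.card := by
  classical
  obtain ⟨D, hD, hmin⟩ := Finset.exists_min_image
    (Finset.univ.filter fun D : Finset (Fin I.m) => ∀ x, ∃ i ∈ D, x ∈ I.S i) Finset.card
    ⟨Finset.univ, by simpa using I.covers⟩
  exact ⟨D, by simpa using hD, fun D' hD' => hmin D' (by simpa using hD')⟩

/-- The approximation on the instances with many elements. -/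
theorem exists_polyTime_of_le (p : ℕ) {c : ℚ} (hc : 0 < c)
    (hA : ((WMMM (2 * (p + 1))).restrict fun I : WeightedGraph =>
      IsChordal I.G).HasPolyTimeApprox
        fun I => max 1 ((c : ℝ) * Real.log (I.1 : WeightedGraph).n)) {d : ℕ} (hd : 1 < d) :
    ∃ D : (I : {I : SetCoverInstance // I.m ≤ I.n ^ d ∧ 4 * (p + 3) ≤ I.n}) → Finset (Fin I.1.m),
      PolyTime (ι := {I : SetCoverInstance // I.m ≤ I.n ^ d ∧ 4 * (p + 3) ≤ I.n})
        (fun I => I.1.encode.size) (fun I => I.1.encode) (fun I => I.1.vector (D I)) ∧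
      ∀ I, (∀ x, ∃ i ∈ D I, x ∈ I.1.S i) ∧
        ∀ D' : Finset (Fin I.1.m), (∀ x, ∃ i ∈ D', x ∈ I.1.S i) →
          ((D I).card : ℝ) ≤ max 1 ((c : ℝ) * (d + 1) * Real.log I.1.n) * D'.card := by
  obtain ⟨A, qA, hA⟩ := hA
  obtain ⟨C, hC, hC₂⟩ : ∃ C : ℕ, (c : ℝ) ≤ C ∧ 2 ≤ C := by
    obtain ⟨C, hC⟩ := exists_nat_ge (c : ℝ)
    exact ⟨C + 2, by push_cast; linarith, by omega⟩
  -- The exponent `K * (n + m)` of the weights is at least `C + 2 * |V|` as `n` is positive.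
  let K := C + 2 * (p + 3)
  let k (I : SetCoverInstance) : ℕ := K * (I.n + I.m)
  choose M t hrun ht hmax hopt using fun I : SetCoverInstance =>
    hA ⟨I.weightedGraph p (k I), I.isChordal_graph p⟩
  refine ⟨fun I => I.1.coverOf p (M I.1), ?_, fun I => ?_⟩
  · have hmatch : PolyTime (fun I : SetCoverInstance => I.encode.size) encode
        fun I => (WMMM (2 * (p + 1))).encodeSol (I.weightedGraph p (k I)) (M I) :=
      (polyTime_weightedGraph p K).comp (PolyTime.mono
        ⟨A, qA, fun I => ⟨t I, hrun I, ht I⟩⟩ (polyBounded_size_weightedGraph p K))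
    exact ((hmatch.cons PolyTime.refl).comp (polyTime_coverOf p (I := fun I => I) M)).comap
      fun I : {I : SetCoverInstance // I.m ≤ I.n ^ d ∧ 4 * (p + 3) ≤ I.n} => I.1
  · have hk : C + 2 * ((p + 3) * (I.1.n + I.1.m)) ≤ k I.1 := by
      have h : 1 ≤ I.1.n + I.1.m := by have := I.2.2; omega
      have : C ≤ C * (I.1.n + I.1.m) := Nat.le_mul_of_pos_right C h
      simp only [k, K]
      nlinarith
    exact coverOf_approx (c := c) (by exact_mod_cast hc) hC hC₂
      (by omega) I.2.1 I.2.2 hk (hmax I.1) (hopt I.1)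

end SetCoverInstance

theorem theorem3 (l : ℕ) (hl : 1 ≤ l) (c : ℚ) (hc : 0 < c)
    (hA : ((WMMM (2 * l)).restrict fun I : WeightedGraph => IsChordal I.G).HasPolyTimeApprox
      fun I => max 1 ((c : ℝ) * Real.log (I.1 : WeightedGraph).n))
    (d : ℕ) (hd : 1 < d) :
    (SetCover.restrict fun I : SetCoverInstance => I.m ≤ I.n ^ d).HasPolyTimeApprox
      fun I => max 1 ((c : ℝ) * (d + 1) * Real.log (I.1 : SetCoverInstance).n) := by
  obtain ⟨p, rfl⟩ : ∃ p, l = p + 1 := ⟨l - 1, by omega⟩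
  obtain ⟨D, hpoly, hD⟩ := SetCoverInstance.exists_polyTime_of_le p hc hA hd
  choose D₀ hD₀ hopt using SetCoverInstance.exists_optimal
  let sol (I : {I : SetCoverInstance // I.m ≤ I.n ^ d}) : Finset (Fin I.1.m) :=
    if hn : 4 * (p + 3) ≤ I.1.n then D ⟨I.1, I.2, hn⟩ else D₀ I.1
  have hfin : {I : {I : SetCoverInstance // I.m ≤ I.n ^ d} | I.1.n < 4 * (p + 3)}.Finite :=
    Set.Finite.of_finite_image ((SetCoverInstance.finite_setOf_n_lt d (4 * (p + 3))).subset
      (by rintro _ ⟨I, hI, rfl⟩; exact ⟨hI, I.2⟩)) Subtype.val_injective.injOn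
  obtain ⟨P, q, hP⟩ := PolyTime.of_finite_compl (N := fun I => I.1.encode.size)
    (g := fun I => I.1.encode) (f := fun I => I.1.vector (sol I))
    (fun I J h => Subtype.ext (SetCoverInstance.encode_injective h)) hfin
    ((hpoly.comap fun I : {I // I ∉ {I : {I : SetCoverInstance // I.m ≤ I.n ^ d} |
      I.1.n < 4 * (p + 3)}} => ⟨I.1.1, I.1.2, not_lt.1 I.2⟩).congr fun I => by
      rw [show sol I.1 = _ from dif_pos (not_lt.1 I.2)])
  refine ⟨P, q, fun I => ?_⟩
  obtain ⟨t, hrun, ht⟩ := hP I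
  refine ⟨sol I, t, hrun, ht, ?_⟩
  have key : (∀ x, ∃ i ∈ sol I, x ∈ I.1.S i) ∧
      ∀ D' : Finset (Fin I.1.m), (∀ x, ∃ i ∈ D', x ∈ I.1.S i) →
        ((sol I).card : ℝ) ≤ max 1 ((c : ℝ) * (d + 1) * Real.log I.1.n) * D'.card := by
    by_cases hn : 4 * (p + 3) ≤ I.1.n
    · rw [show sol I = _ from dif_pos hn]
      exact hD ⟨I.1, I.2, hn⟩
    · rw [show sol I = _ from dif_neg hn]
      refine ⟨hD₀ _, fun D' hD' => ?_⟩
      have h : ((D₀ I.1).card : ℝ) ≤ D'.card := by exact_mod_cast hopt I.1 D' hD'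
      exact h.trans (le_mul_of_one_le_left (Nat.cast_nonneg _) (le_max_left _ _))
  refine ⟨key.1, fun D' hD' => ?_⟩
  have := key.2 D' hD'
  simpa [SetCover, MinProblem.restrict] using this
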